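/- **Definitions.** A hypergraph $\mathcal H$ consists of a nonempty finite vertex set $V(\mathcal H)$ and a set $E(\mathcal H)$ of nonempty subsets of $V(\mathcal H)$, its edges. The general Kneser graph $\operatorname{KG}(\mathcal H)$ has the edges of $\mathcal H$ as its vertices, two of them being adjacent if they are disjoint. For $\boldsymbol x\in\{+,-,0\}^n$ let $\boldsymbol x^+=\{i: x_i=+\}$, $\boldsymbol x^-=\{i: x_i=-\}$, let $|\boldsymbol x|$ be the number of nonzero entries of $\boldsymbol x$, and let $\operatorname{alt}(\boldsymbol x)$ be the largest length of a subsequence of nonzero terms of $\boldsymbol x$ in which any two consecutive terms are different ($\operatorname{alt}(\boldsymbol 0)=0$). For a bijection $\sigma:[n]\to V(\mathcal H)$ let $$\operatorname{alt}_\sigma(\mathcal H)=\max\{\operatorname{alt}(\boldsymbol x):\ \boldsymbol x\in\{+,-,0\}^n,\ \text{neither } \sigma(\boldsymbol x^+) \text{ nor } \sigma(\boldsymbol x^-) \text{ contains an edge of } \mathcal H\}.$$ The hypergraph $\mathcal H$ is *nice* if it has at least one edge, no edge with exactly one vertex, and there is a bijection $\sigma:[n]\to V(\mathcal H)$ such that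 - $\chi(\operatorname{KG}(\mathcal H))=n-\operatorname{alt}_\sigma(\mathcal H)$, and - for every $\boldsymbol x\in\{+,-,0\}^n$ with $\operatorname{alt}(\boldsymbol x)\ge \operatorname{alt}_\sigma(\mathcal H)$ and $|\boldsymbol x|>\operatorname{alt}_\sigma(\mathcal H)$, at least one of $\sigma(\boldsymbol x^+)$ and $\sigma(\boldsymbol x^-)$ contains an edge of $\mathcal H$. The categorical product $G_1\times\cdots\times G_s$ of graphs has vertex set $V(G_1)\times\cdots\times V(G_s)$, with $(u_1,\dots,u_s)$ and $(v_1,\dots,v_s)$ adjacent if $u_jv_j\in E(G_j)$ for every $j$. The graph $K^*_{t,t}$ is the complete bipartite graph $K_{t,t}$ with the edges of a perfect matching removed (its two sides are those of $K_{t,t}$). **Theorem.** Let $s\ge 1$, let $\mathcal H_1,\dots,\mathcal H_s$ be nice hypergraphs and let $t=\min_{1\le j\le s}\chi(\operatorname{KG}(\mathcal H_j))$. Then every proper coloring of $\operatorname{KG}(\mathcal H_1)\times\cdots\times\operatorname{KG}(\mathcal H_s)$ with $t$ colors contains a (not necessarily induced) copy of $K^*_{t,t}$ such that all $t$ colors appear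 on each of its two sides. -/

import Mathlib

/-- `IsAltSubseq x i`: the indices `i 0 < i 1 < ...` select an alternating subsequence of the sign
vector `x`, that is, nonzero terms of which any two consecutive ones are different.  Sign vectors
in `{+, -, 0}ⁿ` are functions `Fin n → SignType`. -/
def IsAltSubseq {n l : ℕ} (x : Fin n → SignType) (i : Fin l → Fin n) : Prop :=
  StrictMono i ∧ (∀ a, x (i a) ≠ 0) ∧ ∀ a b : Fin l, (a : ℕ) + 1 = b → x (i a) ≠ x (i b)

/-- `alt(x)`: the length of a longest alternating subsequence of `x`.  The set of lengths contains
`0` and is bounded by `n`, so the supremum is a maximum; it is `0` for `x = 0`. -/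
noncomputable def signAlt {n : ℕ} (x : Fin n → SignType) : ℕ :=
  sSup {l : ℕ | ∃ i : Fin l → Fin n, IsAltSubseq x i}

/-- `|x|`: the number of nonzero entries of `x`. -/
def signSupp {n : ℕ} (x : Fin n → SignType) : ℕ :=
  (Finset.univ.filter fun i => x i ≠ 0).card

namespace Hypergraph

variable {α : Type*}

/-- The general Kneser graph `KG(H)`: its vertices are the edges of `H`, and two of them are
adjacent when they are disjoint (`e ≠ f` only matters if `∅` is an edge of `H`). -/
def kneserGraph (H : Hypergraph α) : SimpleGraph H.edgeSet where
  Adj e f := e ≠ f ∧ Disjoint (e : Set α) (f : Set α)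
  symm := ⟨fun _ _ h => ⟨h.1.symm, h.2.symm⟩⟩
  loopless := ⟨fun _ h => h.1 rfl⟩

/-- At least one of `σ(x⁺)` and `σ(x⁻)` contains an edge of `H`. -/
def SignContainsEdge (H : Hypergraph α) {n : ℕ} (σ : Fin n ≃ H.vertexSet)
    (x : Fin n → SignType) : Prop :=
  ∃ e ∈ H.edgeSet, e ⊆ (fun i => (σ i : α)) '' {i | x i = 1} ∨
    e ⊆ (fun i => (σ i : α)) '' {i | x i = -1}

/-- `alt_σ(H)`: the maximum of `alt(x)` over the sign vectors `x` such that none of `σ(x⁺)` and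
`σ(x⁻)` contains an edge of `H`.  If `∅` is not an edge, then `x = 0` is such a vector. -/
noncomputable def altOrd (H : Hypergraph α) {n : ℕ} (σ : Fin n ≃ H.vertexSet) : ℕ :=
  sSup {a : ℕ | ∃ x : Fin n → SignType, ¬ H.SignContainsEdge σ x ∧ signAlt x = a}

/-- Nice hypergraphs.  The bijection `σ` makes the vertex set finite.  As `alt_σ(H) ≤ n`, the
equality `χ(KG(H)) = n - alt_σ(H)` is written without subtraction. -/
def IsNice (H : Hypergraph α) : Prop :=
  H.edgeSet.Nonempty ∧ (∀ v : α, {v} ∉ H.edgeSet) ∧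
    ∃ (n : ℕ) (σ : Fin n ≃ H.vertexSet),
      H.kneserGraph.chromaticNumber + (H.altOrd σ : ℕ∞) = (n : ℕ∞) ∧
      ∀ x : Fin n → SignType, H.altOrd σ ≤ signAlt x → H.altOrd σ < signSupp x →
        H.SignContainsEdge σ x

end Hypergraph

/-- The categorical product of a family of graphs: `u` and `v` are adjacent when `u j` and `v j`
are adjacent for every `j` (`u ≠ v` only matters for the empty family). -/
def catProd {ι : Type*} {V : ι → Type*} (G : ∀ j, SimpleGraph (V j)) :
    SimpleGraph (∀ j, V j) where
  Adj u v := u ≠ v ∧ ∀ j, (G j).Adj (u j) (v j)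
  symm := ⟨fun _ _ h => ⟨h.1.symm, fun j => (h.2 j).symm⟩⟩
  loopless := ⟨fun _ h => h.1 rfl⟩

/-- `K*_{t,t}`: the complete bipartite graph `K_{t,t}` without the edges of a perfect matching. -/
def starBipartite (t : ℕ) : SimpleGraph (Fin t ⊕ Fin t) :=
  (completeBipartiteGraph (Fin t) (Fin t)).deleteEdges
    (Set.range fun i : Fin t => s(Sum.inl i, Sum.inr i))

/-! Fix orderings that witness niceness, let a_j be the corresponding alternation number of H_j, and
keep only the first a_j + t vertices of H_j; they exist because n_j - a_j is the chromatic number,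
which is at least t. Put N = ∑ (a_j + t). Sign vectors on the disjoint union of these vertex sets
receive a label in {0, ..., N} and a sign. The label is monotone, comparable nonzero vectors with
equal labels have equal signs, and negating a nonzero vector reverses its sign (`label_mono`,
`labelSign_neg`). The t largest labels are reserved for vectors one of whose sides contains an edge
in every block: such a label is N - t plus the largest color of a tuple of edges lying on one side,
and the sign tells which side has that color, which is well defined for a proper coloring.

The topological input is a form of Fan's lemma modulo two, `exists_all_patterns`. For a sign
function reversed by negation, the number of maximal chains with a prescribed sign pattern is odd;
along a chain with alternating signs the labels must be 1, ..., N. Cut these chains at label N - t.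
If all covers of z have larger labels, the parity of the number of continuations above z does not
depend on the pattern on the top t labels. So some z has continuations with all 2^t patterns: the
colors can be split between the two sides of vectors above z in any prescribed way.

Equality in the label estimates makes z extremal (`exists_isCritical`): one block has exactly t
zeros and no edge on either side, while every other block is full with edges on both sides. Filling
the l-th zero with + creates a tuple of edges A_l on the positive side, filling it with - creates
B_l on the negative side. A_l and B_m can meet only in a common filled position, so they are
adjacent for l ≠ m. The split in which color k alone is positive shows that some A_l has color k
(`HasAllSplits.surjective`), and symmetrically for the B_l. As no edge is a singleton, A_l ≠ B_l.

Monotonicity of the label requires t ≥ 3 or s = 1; the remaining small cases are settled directly.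
-/

/-! ### Deletion and filling modulo two, and chains of sign vectors. -/

section SignComplex

variable {κ : Type*} [Fintype κ] [DecidableEq κ]

open Function Classical in
/-- Sum of `f` over the sign vectors obtained from `x` by deleting one nonzero entry. -/
noncomputable def delSum (f : (κ → SignType) → ZMod 2) (x : κ → SignType) : ZMod 2 :=
  ∑ a, if x a ≠ 0 then f (update x a 0) else 0

open Function Classical in
/-- Sum of `f` over the sign vectors obtained from `x` by filling in one zero entry. -/
noncomputable def fillSum (f : (κ → SignType) → ZMod 2) (x : κ → SignType) : ZMod 2 :=
  ∑ a, if x a = 0 then f (update x a 1) + f (update x a (-1)) else 0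

open Classical in
/-- The indicator of a proposition, modulo two. -/
noncomputable def ind (p : Prop) : ZMod 2 := if p then 1 else 0

open Function

theorem zmod_two_add_self (a : ZMod 2) : a + a = 0 := CharTwo.add_self_eq_zero a

theorem ind_ne_zero {p : Prop} (h : ind p ≠ 0) : p := by
  by_contra hp
  simp [ind, hp] at h

theorem sum_symm_zmod_two {κ : Type*} [Fintype κ] (F : κ → κ → ZMod 2) (hs : ∀ a b, F a b = F b a)
    (hd : ∀ a, F a a = 0) : ∑ a, ∑ b, F a b = 0 := by
  rw [← Finset.sum_product']
  refine Finset.sum_involution (fun p _ => (p.2, p.1)) ?_ ?_ ?_ ?_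
  · rintro ⟨a, b⟩ _
    simp only
    rw [hs b a, zmod_two_add_self]
  · rintro ⟨a, b⟩ _ h he
    simp only [Prod.mk.injEq] at he
    obtain ⟨rfl, _⟩ := he
    exact h (hd _)
  · simp
  · simp

/-- Two entries can be deleted in either order, so the terms cancel in pairs. The same symmetry
gives the statement for filling. -/
theorem delSum_delSum (f : (κ → SignType) → ZMod 2) (x : κ → SignType) :
    delSum (delSum f) x = 0 := by
  have : delSum (delSum f) x = ∑ a, ∑ b, if x a ≠ 0 ∧ x b ≠ 0 ∧ a ≠ b then
      f (update (update x a 0) b 0) else 0 := by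
    unfold delSum
    refine Finset.sum_congr rfl fun a _ => ?_
    by_cases ha : x a = 0
    · simp [ha]
    · simp only [ne_eq, ha, not_false_eq_true, if_true, true_and]
      refine Finset.sum_congr rfl fun b _ => ?_
      by_cases hab : a = b
      · subst hab; simp
      · simp [hab, update_of_ne (Ne.symm hab)]
  rw [this]
  apply sum_symm_zmod_two
  · intro a b
    by_cases hab : a = b
    · subst hab; rfl
    · rw [update_comm hab]
      simp only [ne_eq, ne_comm (a := a) (b := b)]
      congr 1
      rw [eq_iff_iff]
      tauto
  · simp

theorem fillSum_fillSum (f : (κ → SignType) → ZMod 2) (x : κ → SignType) :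
    fillSum (fillSum f) x = 0 := by
  have : fillSum (fillSum f) x = ∑ a, ∑ b, if x a = 0 ∧ x b = 0 ∧ a ≠ b then
      f (update (update x a 1) b 1) + f (update (update x a 1) b (-1)) +
      (f (update (update x a (-1)) b 1) + f (update (update x a (-1)) b (-1))) else 0 := by
    unfold fillSum
    refine Finset.sum_congr rfl fun a _ => ?_
    by_cases ha : x a = 0
    · simp only [ha, if_true, true_and]
      rw [← Finset.sum_add_distrib]
      refine Finset.sum_congr rfl fun b _ => ?_
      by_cases hab : a = b
      · subst hab; simp
      · by_cases hb : x b = 0 <;> simp [hab, update_of_ne (Ne.symm hab), hb]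
    · simp [ha]
  rw [this]
  apply sum_symm_zmod_two
  · intro a b
    by_cases hab : a = b
    · subst hab; rfl
    · rw [update_comm hab, update_comm hab, update_comm hab, update_comm hab]
      have : (x a = 0 ∧ x b = 0 ∧ a ≠ b) ↔ (x b = 0 ∧ x a = 0 ∧ b ≠ a) := by tauto
      simp only [this]
      congr 1
      ring
  · simp

theorem fillSum_one (x : κ → SignType) : fillSum (fun _ => 1) x = 0 := by
  unfold fillSum
  refine Finset.sum_eq_zero fun a _ => ?_
  rw [zmod_two_add_self]
  simp

theorem fillSum_add (f g : (κ → SignType) → ZMod 2) (x : κ → SignType) :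
    fillSum (fun y => f y + g y) x = fillSum f x + fillSum g x := by
  unfold fillSum
  rw [← Finset.sum_add_distrib]
  refine Finset.sum_congr rfl fun a _ => ?_
  split_ifs
  · ring
  · simp

/-- `y` arises from `x` by filling in one zero entry. -/
def SignCovers (x y : κ → SignType) : Prop :=
  ∃ a, x a = 0 ∧ ∃ e : SignType, e ≠ 0 ∧ y = update x a e

theorem fillSum_congr {f g : (κ → SignType) → ZMod 2} {x : κ → SignType}
    (h : ∀ y, SignCovers x y → f y = g y) : fillSum f x = fillSum g x := by
  unfold fillSum
  refine Finset.sum_congr rfl fun a _ => ?_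
  split_ifs with ha
  · rw [h _ ⟨a, ha, 1, by decide, rfl⟩, h _ ⟨a, ha, -1, by decide, rfl⟩]
  · rfl

theorem fillSum_zero (x : κ → SignType) : fillSum (fun _ => 0) x = 0 := by
  simp [fillSum]

theorem exists_of_fillSum_ne_zero {f : (κ → SignType) → ZMod 2} {x : κ → SignType}
    (h : fillSum f x ≠ 0) : ∃ y, SignCovers x y ∧ f y ≠ 0 := by
  by_contra! hn
  exact h ((fillSum_congr (g := fun _ => 0) hn).trans (fillSum_zero x))

theorem exists_of_delSum_ne_zero {f : (κ → SignType) → ZMod 2} {x : κ → SignType}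
    (h : delSum f x ≠ 0) : ∃ y, SignCovers y x ∧ f y ≠ 0 := by
  obtain ⟨a, _, ha⟩ := Finset.exists_ne_zero_of_sum_ne_zero h
  split_ifs at ha with hx
  · exact ⟨update x a 0, ⟨a, by simp, x a, hx, by simp⟩, ha⟩
  · exact absurd rfl ha

theorem signType_univ : (Finset.univ : Finset SignType) = {0, 1, -1} := by decide

theorem sum_split_entry (h : (κ → SignType) → ZMod 2) (a : κ) :
    ∑ x, h x = ∑ x, if x a = 0 then h x + (h (update x a 1) + h (update x a (-1))) else 0 := by
  have key : ∀ e : SignType, ∑ x, (if x a = e then h x else 0) =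
      ∑ x, if x a = 0 then h (update x a e) else 0 := by
    intro e
    rw [← Finset.sum_filter, ← Finset.sum_filter]
    refine Finset.sum_bij' (fun x _ => update x a 0) (fun x _ => update x a e) ?_ ?_ ?_ ?_ ?_
    · simp
    · simp
    · intro x hx
      simp only [Finset.mem_filter, Finset.mem_univ, true_and] at hx
      subst hx
      simp
    · intro x hx
      simp only [Finset.mem_filter, Finset.mem_univ, true_and] at hx
      rw [← hx]
      simp
    · intro x hx
      simp only [Finset.mem_filter, Finset.mem_univ, true_and] at hx
      subst hx
      simp
  have h1 : ∑ x, h x = ∑ e : SignType, ∑ x, (if x a = e then h x else 0) := by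
    rw [Finset.sum_comm]
    refine Finset.sum_congr rfl fun x _ => ?_
    simp
  rw [h1, Finset.sum_congr rfl fun e _ => key e, Finset.sum_comm]
  refine Finset.sum_congr rfl fun x _ => ?_
  split_ifs with hx
  · have hu : update x a 0 = x := by rw [← hx, update_eq_self]
    rw [signType_univ, Finset.sum_insert (by decide), Finset.sum_pair (by decide), hu]
  · simp

/-- Adjointness: both sides sum f(y) g(x) over all pairs in which x covers y. -/
theorem sum_delSum_mul (f g : (κ → SignType) → ZMod 2) :
    ∑ x, delSum f x * g x = ∑ x, f x * fillSum g x := by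
  unfold delSum fillSum
  simp only [Finset.sum_mul, Finset.mul_sum]
  rw [Finset.sum_comm, Finset.sum_comm (s := Finset.univ (α := κ → SignType))]
  refine Finset.sum_congr rfl fun a _ => ?_
  rw [sum_split_entry _ a]
  refine Finset.sum_congr rfl fun x _ => ?_
  by_cases hx : x a = 0
  · have : update x a 0 = x := by rw [← hx, update_eq_self]
    simp [hx, this, mul_add]
  · simp [hx]

/-- Number modulo two of the chains below `x` whose signs follow the pattern `T`. -/
noncomputable def lowerCount (sg : (κ → SignType) → Prop) (T : ℕ → Prop) :
    ℕ → (κ → SignType) → ZMod 2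
  | 0 => fun x => ind (x = 0)
  | k + 1 => fun x => ind (sg x ↔ T (k + 1)) * delSum (lowerCount sg T k) x

/-- The support of a sign vector. -/
def supp (x : κ → SignType) : Finset κ := Finset.univ.filter fun a => x a ≠ 0

theorem mem_supp {κ : Type*} [Fintype κ] {x : κ → SignType} {a : κ} : a ∈ supp x ↔ x a ≠ 0 := by simp [supp]

theorem delSum_neg (f : (κ → SignType) → ZMod 2) (x : κ → SignType) :
    delSum f (-x) = delSum (fun y => f (-y)) x := by
  unfold delSum
  refine Finset.sum_congr rfl fun a _ => ?_
  have : update (-x) a 0 = -update x a 0 := by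
    ext b
    by_cases hb : b = a
    · subst hb; simp
    · simp [hb]
  simp [this]

theorem ind_iff_not {p q : Prop} : ind (¬ p ↔ q) = 1 + ind (p ↔ q) := by
  by_cases hp : p <;> by_cases hq : q <;> simp [ind, hp, hq] <;> decide

/-- Exactly one of x and -x has the sign required at the top, so the two counts add up to the count
without that requirement. This uses that the latter is invariant under negation, which follows
inductively because the defect is a double deletion. -/
theorem lowerCount_succ_neg {sg : (κ → SignType) → Prop} (T : ℕ → Prop)
    (hsg : ∀ x, x ≠ 0 → (sg (-x) ↔ ¬ sg x)) (k : ℕ) (x : κ → SignType) :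
    lowerCount sg T (k + 1) (-x) = lowerCount sg T (k + 1) x + delSum (lowerCount sg T k) x := by
  have main : ∀ k, (∀ x, delSum (fun y => lowerCount sg T k (-y)) x
      = delSum (lowerCount sg T k) x) → ∀ x,
      lowerCount sg T (k + 1) (-x) = lowerCount sg T (k + 1) x + delSum (lowerCount sg T k) x := by
    intro k hk x
    -- The sign of the zero vector is unconstrained, but nothing can be deleted from it and all
    -- terms vanish.
    by_cases hx : x = 0
    · subst hx
      simp [delSum]
    · simp only [lowerCount]
      rw [delSum_neg, hk]
      have := hsg x hx
      simp only [this, ind_iff_not]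
      ring
  refine main k ?_ x
  induction k with
  | zero =>
    have : ∀ y : κ → SignType, -y = 0 ↔ y = 0 := fun y => by simp [funext_iff]
    simp [lowerCount, this]
  | succ k ih =>
    intro x
    simp only [main k ih]
    have : delSum (fun y => lowerCount sg T (k + 1) y + delSum (lowerCount sg T k) y) x
        = delSum (lowerCount sg T (k + 1)) x + delSum (delSum (lowerCount sg T k)) x := by
      conv_lhs => unfold delSum
      conv_rhs => unfold delSum
      rw [← Finset.sum_add_distrib]
      refine Finset.sum_congr rfl fun a _ => ?_
      split_ifs <;> simp
    rw [this, delSum_delSum, add_zero]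

theorem supp_update_zero (x : κ → SignType) (a : κ) : supp (update x a 0) = (supp x).erase a := by
  ext b
  by_cases hb : b = a
  · subst hb; simp [mem_supp]
  · simp [mem_supp, hb]

theorem supp_update_of_ne_zero (x : κ → SignType) (a : κ) {e : SignType} (he : e ≠ 0) :
    supp (update x a e) = insert a (supp x) := by
  ext b
  by_cases hb : b = a
  · subst hb; simp [mem_supp, he]
  · simp [mem_supp, hb]

theorem card_supp_of_lowerCount_ne_zero {sg : (κ → SignType) → Prop} {T : ℕ → Prop} {k : ℕ}
    {x : κ → SignType} (h : lowerCount sg T k x ≠ 0) : (supp x).card = k := by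
  induction k generalizing x with
  | zero =>
    have := ind_ne_zero h
    subst this
    simp [supp]
  | succ k ih =>
    obtain ⟨y, ⟨a, ha, e, he, rfl⟩, hy⟩ := exists_of_delSum_ne_zero (right_ne_zero_of_mul h)
    rw [supp_update_of_ne_zero _ _ he, Finset.card_insert_of_notMem (by simp [mem_supp, ha]), ih hy]

/-- Induction on the support: pairing x with -x removes the sign condition at the top, and modulo
two only the deletion of the new entry survives. -/
theorem sum_lowerCount_supp {sg : (κ → SignType) → Prop} (T : ℕ → Prop)
    (hsg : ∀ x, x ≠ 0 → (sg (-x) ↔ ¬ sg x)) (S : Finset κ) :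
    ∑ x, (if supp x = S then lowerCount sg T S.card x else 0) = 1 := by
  induction S using Finset.induction_on with
  | empty =>
    rw [Finset.sum_eq_single 0]
    · simp [supp, lowerCount, ind]
    · intro x _ hx
      simp [lowerCount, ind, hx]
    · simp
  | insert a S ha ih =>
    rw [Finset.card_insert_of_notMem ha]
    set k := S.card
    -- Each antipodal pair is represented by its member with + at `a`.
    have h1 : ∑ x, (if supp x = insert a S then lowerCount sg T (k + 1) x else 0) =
        ∑ x, if supp x = insert a S ∧ x a = 1 then delSum (lowerCount sg T k) x else 0 := by
      have e1 : ∀ x : κ → SignType,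
          (if supp x = insert a S then lowerCount sg T (k + 1) x else 0) =
          (if supp x = insert a S ∧ x a = 1 then lowerCount sg T (k + 1) x else 0) +
          (if supp x = insert a S ∧ x a = -1 then lowerCount sg T (k + 1) x else 0) := by
        intro x
        by_cases hx : supp x = insert a S
        · have : x a ≠ 0 := mem_supp.1 (hx ▸ Finset.mem_insert_self a S)
          rcases hxa : x a with _ | _ | _
          · exact absurd hxa this
          · simp [hx]
          · simp [hx]
        · simp [hx]
      have e2 : ∑ x, (if supp x = insert a S ∧ x a = -1 then lowerCount sg T (k + 1) x else 0) =
          ∑ x, (if supp x = insert a S ∧ x a = 1 then lowerCount sg T (k + 1) (-x) else 0) := by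
        rw [← Equiv.sum_comp (Equiv.neg (κ → SignType))]
        refine Finset.sum_congr rfl fun x _ => ?_
        have : supp (-x) = supp x := by ext; simp [mem_supp]
        have h2 : -x a = -1 ↔ x a = 1 := by cases x a <;> decide
        simp [this, h2]
      rw [Finset.sum_congr rfl fun x _ => e1 x, Finset.sum_add_distrib, e2,
        ← Finset.sum_add_distrib]
      refine Finset.sum_congr rfl fun x _ => ?_
      split_ifs with hx
      · rw [lowerCount_succ_neg T hsg, ← add_assoc, zmod_two_add_self, zero_add]
      · simp
    rw [h1, ← ih]
    have h2 : ∀ x : κ → SignType,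
        (if supp x = insert a S ∧ x a = 1 then delSum (lowerCount sg T k) x else 0) =
        ∑ b, if (supp x = insert a S ∧ x a = 1) ∧ x b ≠ 0 then
          lowerCount sg T k (update x b 0) else 0 := by
      intro x
      split_ifs with hx
      · simp [delSum, hx.1, hx.2]
      · simp [hx]
    rw [Finset.sum_congr rfl fun x _ => h2 x, Finset.sum_comm, Finset.sum_eq_single a]
    · rw [← Finset.sum_filter, ← Finset.sum_filter]
      refine Finset.sum_bij' (fun x _ => update x a 0) (fun x _ => update x a 1) ?_ ?_ ?_ ?_ ?_
      · intro x hx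
        simp only [Finset.mem_filter, Finset.mem_univ, true_and] at hx ⊢
        rw [supp_update_zero, hx.1.1, Finset.erase_insert ha]
      · intro x hx
        simp only [Finset.mem_filter, Finset.mem_univ, true_and] at hx ⊢
        rw [supp_update_of_ne_zero _ _ (by decide), hx]
        simp
      · intro x hx
        simp only [Finset.mem_filter, Finset.mem_univ, true_and] at hx
        rw [← hx.1.2]
        simp
      · intro x hx
        simp only [Finset.mem_filter, Finset.mem_univ, true_and] at hx
        have : x a = 0 := by
          by_contra h
          exact ha (hx ▸ mem_supp.2 h)
        rw [update_idem, ← this, update_eq_self]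
      · simp
    -- Deleting `b ≠ a` gives the same vector before and after flipping the entry at `b`, so these
    -- terms cancel.
    · intro b _ hb
      rw [← Finset.sum_filter]
      refine Finset.sum_involution (fun x _ => update x b (-x b)) ?_ ?_ ?_ ?_
      · intro x _
        simp [zmod_two_add_self]
      · intro x hx _ he
        simp only [Finset.mem_filter, Finset.mem_univ, true_and] at hx
        have := congrFun he b
        rw [update_self] at this
        revert this
        have := hx.2
        cases hxb : x b
        · exact absurd hxb this
        · decide
        · decide
      · intro x hx
        simp only [Finset.mem_filter, Finset.mem_univ, true_and] at hx ⊢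
        have hnb : -x b ≠ 0 := by simpa using hx.2
        rw [supp_update_of_ne_zero _ _ hnb, Finset.insert_eq_of_mem (mem_supp.2 hx.2),
          update_of_ne (Ne.symm hb)]
        exact ⟨hx.1, by simpa using hx.2⟩
      · intro x _
        simp
    · simp

/-- The number of maximal chains of sign vectors with a prescribed sign pattern is odd. -/
theorem sum_lowerCount {sg : (κ → SignType) → Prop} (T : ℕ → Prop)
    (hsg : ∀ x, x ≠ 0 → (sg (-x) ↔ ¬ sg x)) :
    ∑ x, lowerCount sg T (Fintype.card κ) x = 1 := by
  rw [← sum_lowerCount_supp T hsg Finset.univ]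
  refine Finset.sum_congr rfl fun x _ => ?_
  split_ifs with hx
  · rfl
  · by_contra h
    exact hx ((Finset.card_eq_iff_eq_univ _).1 (card_supp_of_lowerCount_ne_zero h))

end SignComplex

/-! ### Monotone labels and Fan's lemma modulo two. -/

section MonotoneLabels

open Function

variable {κ : Type*} [Fintype κ] [DecidableEq κ]

/-- Number modulo two of the chains of length `j` above a vector that carry the `j` largest
labels, the label `k` with the sign `T k`. -/
noncomputable def upperCount (m : (κ → SignType) → ℕ) (sg : (κ → SignType) → Prop) (T : ℕ → Prop)
    (N : ℕ) : ℕ → (κ → SignType) → ZMod 2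
  | 0 => fun _ => 1
  | j + 1 => fillSum fun y =>
      ind (m y = N - j ∧ (sg y ↔ T (N - j))) * upperCount m sg T N j y

variable {m : (κ → SignType) → ℕ} {sg : (κ → SignType) → Prop} {N : ℕ}

theorem fillSum_upperCount (T : ℕ → Prop) (j : ℕ) (x : κ → SignType) :
    fillSum (upperCount m sg T N j) x = 0 := by
  cases j with
  | zero => exact fillSum_one x
  | succ j => exact fillSum_fillSum _ x

theorem ind_true {p : Prop} (h : p) : ind p = 1 := by simp [ind, h]

theorem ind_false {p : Prop} (h : ¬ p) : ind p = 0 := by simp [ind, h]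

/-- Only the case where x already has the first label of the chain needs an argument. Covers with
the same label share the sign of x, and covers with larger labels count zero by induction. So either
no cover contributes, or the indicator may be dropped and a double filling remains. -/
theorem upperCount_eq_zero (hN : ∀ x, m x ≤ N)
    (hm : ∀ x y, SignCovers x y → m x ≤ m y ∧ (m x = m y → (sg x ↔ sg y))) (T : ℕ → Prop)
    {j : ℕ} {x : κ → SignType} (hx : N - j < m x) : upperCount m sg T N j x = 0 := by
  induction j generalizing x with
  | zero => exact absurd (hN x) (by omega)
  | succ j ih =>
    by_cases hx1 : N - j < m x
    · refine (fillSum_congr fun y hy => ?_).trans (fillSum_zero x)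
      have := (hm x y hy).1
      rw [ind_false (by omega), zero_mul]
    have hx2 : m x = N - j := by omega
    by_cases hs : sg x ↔ T (N - j)
    · refine (fillSum_congr fun y hy => ?_).trans (fillSum_upperCount (m := m) (sg := sg) (N := N) T j x)
      have h1 := hm x y hy
      by_cases hy1 : m y = N - j
      · rw [ind_true, one_mul]
        exact ⟨hy1, by rw [← h1.2 (by omega)]; exact hs⟩
      · rw [ih (by omega), mul_zero]
    · refine (fillSum_congr fun y hy => ?_).trans (fillSum_zero x)
      rw [ind_false, zero_mul]
      rintro ⟨h2, h3⟩
      exact hs (by rw [(hm x y hy).2 (by omega)]; exact h3)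

/-- Along a chain with alternating signs the label cannot stay constant, so it grows at each step.
-/
theorem le_of_lowerCount_ne_zero
    (hm : ∀ x y, SignCovers x y → m x ≤ m y ∧ (m x = m y → (sg x ↔ sg y)))
    (h0 : ∀ x, x ≠ 0 → 1 ≤ m x) {T : ℕ → Prop} (hT : ∀ k, T (k + 1) ↔ ¬ T k) {k : ℕ}
    {x : κ → SignType} (h : lowerCount sg T k x ≠ 0) :
    k ≤ m x ∧ (k ≠ 0 → (sg x ↔ T k)) := by
  induction k generalizing x with
  | zero => simp
  | succ k ih =>
    have hs := ind_ne_zero (left_ne_zero_of_mul h)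
    obtain ⟨y, hy, hy1⟩ := exists_of_delSum_ne_zero (right_ne_zero_of_mul h)
    refine ⟨?_, fun _ => hs⟩
    have h1 := ih hy1
    have h2 := hm y x hy
    rcases Nat.eq_zero_or_pos k with rfl | hk
    · apply h0
      obtain ⟨a, _, e, he, rfl⟩ := hy
      intro h
      have := congrFun h a
      simp [he] at this
    · by_contra hlt
      have h3 := h2.2 (by omega)
      have h4 := h1.2 (by omega)
      have h5 := hT k
      tauto

/-- The odd number of maximal alternating chains, cut at height N - j. Adjointness moves the cut
down by one step, and vectors whose label exceeds their height contribute nothing. -/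
theorem sum_lowerCount_mul_upperCount (hcard : Fintype.card κ = N) (hN : ∀ x, m x ≤ N)
    (hm : ∀ x y, SignCovers x y → m x ≤ m y ∧ (m x = m y → (sg x ↔ sg y)))
    (h0 : ∀ x, x ≠ 0 → 1 ≤ m x) (hsg : ∀ x, x ≠ 0 → (sg (-x) ↔ ¬ sg x))
    {T : ℕ → Prop} (hT : ∀ k, T (k + 1) ↔ ¬ T k) {j : ℕ} (hj : j ≤ N) :
    ∑ x, lowerCount sg T (N - j) x * upperCount m sg T N j x = 1 := by
  induction j with
  | zero => simp [upperCount, ← hcard, sum_lowerCount T hsg]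
  | succ j ih =>
    rw [← ih (by omega)]
    simp only [upperCount]
    rw [← sum_delSum_mul]
    refine Finset.sum_congr rfl fun x _ => ?_
    obtain ⟨k, hk⟩ : ∃ k, N - j = k + 1 := ⟨N - j - 1, by omega⟩
    have hk' : N - (j + 1) = k := by omega
    rw [hk', hk]
    by_cases h1 : lowerCount sg T (k + 1) x = 0
    · rw [h1, zero_mul]
      have h1' : ind (sg x ↔ T (k + 1)) * delSum (lowerCount sg T k) x = 0 := h1
      by_cases hs : sg x ↔ T (k + 1)
      · rw [ind_true hs, one_mul] at h1'
        rw [h1', zero_mul]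
      · rw [ind_false (fun h => hs h.2)]; simp
    · have h2 := le_of_lowerCount_ne_zero hm h0 hT h1
      by_cases h3 : m x = k + 1
      · rw [ind_true ⟨h3, h2.2 (by omega)⟩]
        simp [lowerCount, ind_true (h2.2 (by omega))]
      · rw [upperCount_eq_zero hN hm T (by omega : N - j < m x)]
        simp

/-- Changing the pattern in one place changes the upper counts only through chains with labels
below the expected ones. -/
theorem exists_fillSum_eq_upperCount_add (hN : ∀ x, m x ≤ N)
    (hm : ∀ x y, SignCovers x y → m x ≤ m y ∧ (m x = m y → (sg x ↔ sg y)))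
    {T T' : ℕ → Prop} {i : ℕ} (hi : i < N) (hTT : ∀ k, k ≠ N - i → (T k ↔ T' k))
    (hTi : T (N - i) ↔ ¬ T' (N - i)) {j : ℕ} (hij : i < j) (hj : j ≤ N) :
    ∃ K : (κ → SignType) → ZMod 2, (∀ x, fillSum K x = 0) ∧
      ∀ x, upperCount m sg T N j x + upperCount m sg T' N j x =
        fillSum (fun y => ind (m y < N - j + 1) * K y) x := by
  have hsame : ∀ j ≤ i, ∀ x, upperCount m sg T N j x = upperCount m sg T' N j x := by
    intro j hj
    induction j with
    | zero => intro x; rfl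
    | succ j ih =>
      intro x
      refine fillSum_congr fun y _ => ?_
      rw [ih (by omega), hTT (N - j) (by omega)]
  induction j, hij using Nat.le_induction with
  | base =>
    -- The two patterns together count covers of label N - i with either sign. Adding the vanishing
    -- sum over all covers leaves those of smaller label, since larger labels have upper count zero.
    refine ⟨upperCount m sg T N i, fillSum_upperCount T i, fun x => ?_⟩
    have e0 := fillSum_upperCount (m := m) (sg := sg) (N := N) T i x
    rw [← add_zero (upperCount m sg T N _ x + _), ← e0, Nat.succ_eq_add_one]
    simp only [upperCount]
    rw [← fillSum_add, ← fillSum_add]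
    refine fillSum_congr fun y _ => ?_
    rw [← hsame i le_rfl y]
    have hi' : N - (i + 1) + 1 = N - i := by omega
    rw [hi']
    rcases lt_trichotomy (m y) (N - i) with h | h | h
    · rw [ind_false (by omega), ind_false (by omega), ind_true h]
      ring
    · rw [ind_false (p := m y < N - i) (by omega)]
      by_cases hs : sg y ↔ T (N - i)
      · rw [ind_true ⟨h, hs⟩, ind_false (by tauto)]
        simp [zmod_two_add_self]
      · rw [ind_false (by tauto), ind_true ⟨h, by tauto⟩]
        simp [zmod_two_add_self]
    · rw [upperCount_eq_zero hN hm T h]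
      simp
  | succ j hij ih =>
    have hij' : i < j := hij
    obtain ⟨K, hK, hF⟩ := ih (by omega)
    set A : (κ → SignType) → ZMod 2 := fun y => ind (m y = N - j ∧ (sg y ↔ T (N - j))) with hA
    -- Adding the double filling of `A * K`, which is zero, trades the restriction on the second
    -- vector of the chain for one on the first: if `A y = 1` the contributions of the covers of `y`
    -- cancel, and if `A y = 0` a cover `w` with `A w = 1` forces a smaller label at `y`.
    refine ⟨fillSum fun y => A y * K y, fillSum_fillSum _, fun x => ?_⟩
    rw [← add_zero (upperCount m sg T N _ x + _), ← fillSum_fillSum (fun y => A y * K y) x]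
    simp only [upperCount]
    rw [← fillSum_add, ← fillSum_add]
    refine fillSum_congr fun y _ => ?_
    rw [← hTT (N - j) (by omega)]
    have h1 : ind (m y = N - j ∧ (sg y ↔ T (N - j))) = A y := rfl
    rw [h1, ← mul_add, hF y]
    have hj' : N - (j + 1) + 1 = N - j := by omega
    rw [hj']
    by_cases hAy : m y = N - j ∧ (sg y ↔ T (N - j))
    · have hA1 : A y = 1 := ind_true hAy
      rw [hA1, one_mul, ind_false (by omega), zero_mul]
      rw [← fillSum_add]
      refine (fillSum_congr fun w hw => ?_).trans (fillSum_zero y)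
      have h2 := hm y w hw
      by_cases hw1 : m w = N - j
      · rw [ind_true (by omega)]
        have : A w = 1 := ind_true ⟨hw1, by rw [← h2.2 (by omega)]; exact hAy.2⟩
        rw [this, zmod_two_add_self]
      · rw [ind_false (by omega)]
        have : A w = 0 := ind_false (by tauto)
        rw [this]
        simp
    · have hA0 : A y = 0 := ind_false hAy
      rw [hA0, zero_mul, zero_add]
      by_cases h3 : m y < N - j
      · rw [ind_true h3, one_mul]
      · rw [ind_false h3, zero_mul]
        refine (fillSum_congr fun w hw => ?_).trans (fillSum_zero y)
        have h2 := hm y w hw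
        have : A w = 0 := by
          refine ind_false fun h4 => hAy ?_
          have h5 : m y = m w := by omega
          exact ⟨by omega, by rw [h2.2 h5]; exact h4.2⟩
        rw [this, zero_mul]

theorem upperCount_eq_of_flip (hN : ∀ x, m x ≤ N)
    (hm : ∀ x y, SignCovers x y → m x ≤ m y ∧ (m x = m y → (sg x ↔ sg y)))
    {T T' : ℕ → Prop} {i j : ℕ} (hTT : ∀ k, k ≠ N - i → (T k ↔ T' k))
    (hij : i < j) (hj : j ≤ N) {z : κ → SignType} (hz : ∀ y, SignCovers z y → N - j < m y) :
    upperCount m sg T N j z = upperCount m sg T' N j z := by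
  by_cases hTi : T (N - i) ↔ ¬ T' (N - i)
  · obtain ⟨K, _, hF⟩ := exists_fillSum_eq_upperCount_add hN hm (by omega) hTT hTi hij hj
    rw [← sub_eq_zero, sub_eq_add_neg, ZMod.neg_eq_self_mod_two, hF]
    refine (fillSum_congr fun y hy => ?_).trans (fillSum_zero z)
    have := hz y hy
    rw [ind_false (by omega), zero_mul]
  · have : T = T' := by
      ext k
      by_cases hk : k = N - i
      · subst hk; tauto
      · exact hTT k hk
    rw [this]

theorem upperCount_congr {T T' : ℕ → Prop} {j : ℕ} (h : ∀ i < j, (T (N - i) ↔ T' (N - i)))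
    (x : κ → SignType) : upperCount m sg T N j x = upperCount m sg T' N j x := by
  induction j generalizing x with
  | zero => rfl
  | succ j ih =>
    refine fillSum_congr fun y _ => ?_
    rw [ih (fun i hi => h i (by omega)), h j (by omega)]

/-- Above a vector all of whose covers have large labels, the upper counts are the same for all
sign patterns. -/
theorem upperCount_eq (hN : ∀ x, m x ≤ N)
    (hm : ∀ x y, SignCovers x y → m x ≤ m y ∧ (m x = m y → (sg x ↔ sg y)))
    (T T' : ℕ → Prop) {j : ℕ} (hj : j ≤ N) {z : κ → SignType}
    (hz : ∀ y, SignCovers z y → N - j < m y) :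
    upperCount m sg T N j z = upperCount m sg T' N j z := by
  -- The pattern is changed one label at a time, from the top.
  have main : ∀ l ≤ j, upperCount m sg T N j z =
      upperCount m sg (fun k => if N - l < k then T' k else T k) N j z := by
    intro l hl
    induction l with
    | zero =>
      refine upperCount_congr (fun i _ => ?_) z
      rw [if_neg (by omega)]
    | succ l ih =>
      rw [ih (by omega)]
      refine upperCount_eq_of_flip hN hm (i := l) (fun k hk => ?_) (by omega) hj hz
      by_cases h : N - l < k
      · rw [if_pos h, if_pos (by omega)]
      · rw [if_neg h, if_neg (by omega)]
  rw [main j le_rfl]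
  refine upperCount_congr (fun i hi => ?_) z
  rw [if_pos (by omega)]

theorem SignCovers.eq_of_ne_zero {κ : Type*} [DecidableEq κ] {x y : κ → SignType} (h : SignCovers x y) {a : κ}
    (ha : x a ≠ 0) : y a = x a := by
  obtain ⟨b, hb, e, _, rfl⟩ := h
  rw [update_of_ne]
  rintro rfl
  exact ha hb

theorem exists_of_upperCount_ne_zero {T : ℕ → Prop} {j : ℕ} {z : κ → SignType}
    (h : upperCount m sg T N j z ≠ 0) :
    ∃ y : κ → SignType, (∀ a, z a ≠ 0 → y a = z a) ∧ ∀ i < j, ∃ u : κ → SignType, (∀ a, z a ≠ 0 → u a = z a) ∧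
      (∀ a, u a ≠ 0 → y a = u a) ∧ m u = N - i ∧ (sg u ↔ T (N - i)) := by
  induction j generalizing z with
  | zero => exact ⟨z, fun _ _ => rfl, by simp⟩
  | succ j ih =>
    obtain ⟨w, hw, hw1⟩ := exists_of_fillSum_ne_zero h
    have hw2 := ind_ne_zero (left_ne_zero_of_mul hw1)
    obtain ⟨y, hy, hu⟩ := ih (right_ne_zero_of_mul hw1)
    have step : ∀ v : κ → SignType, (∀ a, w a ≠ 0 → v a = w a) → ∀ a, z a ≠ 0 → v a = z a := by
      intro v hv a ha
      have := hw.eq_of_ne_zero ha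
      rw [hv a (by rw [this]; exact ha), this]
    refine ⟨y, step y hy, fun i hi => ?_⟩
    rcases Nat.lt_succ_iff_lt_or_eq.1 hi with hi | rfl
    · obtain ⟨u, h1, h2⟩ := hu i hi
      exact ⟨u, step u h1, h2⟩
    · exact ⟨w, fun a ha => hw.eq_of_ne_zero ha, hy, hw2⟩

/-- A combinatorial form of Fan's lemma for monotone labels: some vector `z` of label `N - j` has
above it chains with every sign pattern on the `j` largest labels, provided that no cover of such
a vector has a small label. -/
theorem exists_all_patterns (hcard : Fintype.card κ = N) (hN : ∀ x, m x ≤ N)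
    (hm : ∀ x y, SignCovers x y → m x ≤ m y ∧ (m x = m y → (sg x ↔ sg y)))
    (h0 : ∀ x, x ≠ 0 → 1 ≤ m x) (hsg : ∀ x, x ≠ 0 → (sg (-x) ↔ ¬ sg x)) {j : ℕ} (hj : j ≤ N)
    (hz : ∀ z, m z = N - j → ∀ y, SignCovers z y → N - j < m y) :
    ∃ z : κ → SignType, m z = N - j ∧ ∀ T : ℕ → Prop,
      ∃ y : κ → SignType, (∀ a, z a ≠ 0 → y a = z a) ∧ ∀ i < j, ∃ u : κ → SignType, (∀ a, z a ≠ 0 → u a = z a) ∧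
        (∀ a, u a ≠ 0 → y a = u a) ∧ m u = N - i ∧ (sg u ↔ T (N - i)) := by
  have hT : ∀ k, Even (k + 1) ↔ ¬ Even k := fun k => Nat.even_add_one
  have h1 := sum_lowerCount_mul_upperCount hcard hN hm h0 hsg hT hj
  obtain ⟨z, _, hzne⟩ := Finset.exists_ne_zero_of_sum_ne_zero (h1.trans_ne one_ne_zero)
  have h2 := (le_of_lowerCount_ne_zero hm h0 hT (left_ne_zero_of_mul hzne)).1
  have h3 : ¬ N - j < m z := fun h =>
    right_ne_zero_of_mul hzne (upperCount_eq_zero hN hm _ h)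
  refine ⟨z, by omega, fun T => exists_of_upperCount_ne_zero ?_⟩
  -- Parity is known for the alternating pattern only; independence of the pattern transfers it to
  -- `T`.
  rw [upperCount_eq hN hm T (fun k => Even k) hj (hz z (by omega))]
  exact right_ne_zero_of_mul hzne

end MonotoneLabels

/-! ### Alternation number and leading sign. -/

section AlternatingSign

variable {n : ℕ} {x y : Fin n → SignType}

/-- Every nonzero entry of `x` is also an entry of `y`. -/
def SignLe {κ : Type*} (x y : κ → SignType) : Prop := ∀ a, x a ≠ 0 → y a = x a

theorem SignLe.neg {κ : Type*} {x y : κ → SignType} (h : SignLe x y) : SignLe (-x) (-y) := by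
  intro a ha
  have : x a ≠ 0 := by simpa using ha
  simp [h a this]

theorem IsAltSubseq.mono (h : SignLe x y) {l : ℕ} {i : Fin l → Fin n} (hi : IsAltSubseq x i) :
    IsAltSubseq y i := by
  obtain ⟨h1, h2, h3⟩ := hi
  have : ∀ a, y (i a) = x (i a) := fun a => h _ (h2 a)
  exact ⟨h1, fun a => by rw [this]; exact h2 a, fun a b hab => by
    rw [this, this]; exact h3 a b hab⟩

theorem IsAltSubseq.neg {l : ℕ} {i : Fin l → Fin n} (hi : IsAltSubseq x i) :
    IsAltSubseq (-x) i := by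
  obtain ⟨h1, h2, h3⟩ := hi
  exact ⟨h1, fun a => by simpa using h2 a, fun a b hab => by simpa using h3 a b hab⟩

theorem IsAltSubseq.le_signSupp {l : ℕ} {i : Fin l → Fin n} (hi : IsAltSubseq x i) :
    l ≤ signSupp x := by
  have : (Finset.univ.image i).card = l := by
    rw [Finset.card_image_of_injective _ hi.1.injective, Finset.card_univ, Fintype.card_fin]
  rw [← this]
  refine Finset.card_le_card fun a ha => ?_
  obtain ⟨b, _, rfl⟩ := Finset.mem_image.1 ha
  simpa using hi.2.1 b

theorem bddAbove_altLengths (x : Fin n → SignType) :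
    BddAbove {l : ℕ | ∃ i : Fin l → Fin n, IsAltSubseq x i} :=
  ⟨signSupp x, fun _ ⟨_, hi⟩ => hi.le_signSupp⟩

theorem exists_isAltSubseq (x : Fin n → SignType) :
    ∃ i : Fin (signAlt x) → Fin n, IsAltSubseq x i :=
  Nat.sSup_mem (s := {l : ℕ | ∃ i : Fin l → Fin n, IsAltSubseq x i})
    ⟨0, Fin.elim0, fun a => a.elim0, fun a => a.elim0, fun a => a.elim0⟩ (bddAbove_altLengths x)

theorem IsAltSubseq.le_signAlt {l : ℕ} {i : Fin l → Fin n} (hi : IsAltSubseq x i) :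
    l ≤ signAlt x :=
  le_csSup (bddAbove_altLengths x) ⟨i, hi⟩

theorem signAlt_mono (h : SignLe x y) : signAlt x ≤ signAlt y := by
  obtain ⟨i, hi⟩ := exists_isAltSubseq x
  exact (hi.mono h).le_signAlt

theorem signAlt_neg (x : Fin n → SignType) : signAlt (-x) = signAlt x := by
  have key : ∀ x : Fin n → SignType, signAlt x ≤ signAlt (-x) := fun x => by
    obtain ⟨i, hi⟩ := exists_isAltSubseq x
    exact hi.neg.le_signAlt
  refine le_antisymm ?_ (key x)
  have := key (-x)
  rwa [show - -x = x by ext; simp] at this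

theorem signAlt_le_signSupp (x : Fin n → SignType) : signAlt x ≤ signSupp x := by
  obtain ⟨i, hi⟩ := exists_isAltSubseq x
  exact hi.le_signSupp

theorem signSupp_mono (h : SignLe x y) : signSupp x ≤ signSupp y := by
  refine Finset.card_le_card fun a ha => ?_
  simp only [Finset.mem_filter, Finset.mem_univ, true_and] at ha ⊢
  rwa [h a ha]

theorem signSupp_le (x : Fin n → SignType) : signSupp x ≤ n :=
  (Finset.card_le_univ _).trans_eq (Fintype.card_fin n)

theorem signSupp_neg (x : Fin n → SignType) : signSupp (-x) = signSupp x := by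
  simp [signSupp]

theorem SignLe.eq_of_signSupp_le (h : SignLe x y) (hc : signSupp y ≤ signSupp x) : x = y := by
  have hsub : (Finset.univ.filter fun i => x i ≠ 0) ⊆ Finset.univ.filter fun i => y i ≠ 0 := by
    intro a ha
    simp only [Finset.mem_filter, Finset.mem_univ, true_and] at ha ⊢
    rwa [h a ha]
  have heq := Finset.eq_of_subset_of_card_le hsub hc
  ext a
  by_cases ha : x a = 0
  · by_contra hne
    have : a ∈ Finset.univ.filter fun i => y i ≠ 0 := by
      simp only [Finset.mem_filter, Finset.mem_univ, true_and]
      intro h0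
      exact hne (ha.trans h0.symm)
    rw [← heq] at this
    simp [ha] at this
  · exact (h a ha).symm

theorem signSupp_pos (hx : x ≠ 0) : 1 ≤ signSupp x := by
  obtain ⟨a, ha⟩ := Function.ne_iff.1 hx
  exact Finset.card_pos.2 ⟨a, by simpa using ha⟩

theorem signSupp_zero : signSupp (0 : Fin n → SignType) = 0 := by
  simp [signSupp]

theorem signAlt_zero : signAlt (0 : Fin n → SignType) = 0 := by
  have := signAlt_le_signSupp (0 : Fin n → SignType)
  rw [signSupp_zero] at this
  omega

theorem signAlt_pos (hx : x ≠ 0) : 1 ≤ signAlt x := by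
  obtain ⟨a, ha⟩ := Function.ne_iff.1 hx
  have : IsAltSubseq x (fun _ : Fin 1 => a) :=
    ⟨Subsingleton.strictMono _, fun _ => ha, fun b c h => by omega⟩
  exact this.le_signAlt

theorem IsAltSubseq.cons {l : ℕ} {i : Fin (l + 1) → Fin n} (hi : IsAltSubseq x i) {p : Fin n}
    (hp : x p ≠ 0) (hlt : p < i 0) (hne : x p ≠ x (i 0)) :
    IsAltSubseq x (Fin.cons p i : Fin (l + 2) → Fin n) := by
  obtain ⟨h1, h2, h3⟩ := hi
  refine ⟨?_, ?_, ?_⟩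
  · rw [Fin.strictMono_iff_lt_succ]
    intro a
    refine Fin.cases ?_ (fun a => ?_) a
    · simpa using hlt
    · have : (a.succ).castSucc = (a.castSucc).succ := by ext; simp
      rw [this, Fin.cons_succ, Fin.cons_succ]
      exact h1 (by simp [Fin.lt_def])
  · intro a
    refine Fin.cases ?_ (fun a => ?_) a
    · simpa using hp
    · simpa using h2 a
  · intro a b
    refine Fin.cases ?_ (fun b => ?_) b
    · intro h
      simp at h
    · refine Fin.cases ?_ (fun a => ?_) a
      · intro h
        have : b = 0 := by ext; simpa using h.symm
        subst this
        simpa using hne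
      · intro h
        simp only [Fin.cons_succ]
        refine h3 a b ?_
        simpa using h

/-- Some longest alternating subsequence of `x` starts with the sign `e`. -/
def LeadSign (x : Fin n → SignType) (e : SignType) : Prop :=
  ∃ (l : ℕ) (i : Fin (l + 1) → Fin n), l + 1 = signAlt x ∧ IsAltSubseq x i ∧ x (i 0) = e

theorem leadSign_mono (h : SignLe x y) (ha : signAlt x = signAlt y) {e : SignType}
    (hx : LeadSign x e) : LeadSign y e := by
  obtain ⟨l, i, h1, h2, h3⟩ := hx
  exact ⟨l, i, h1.trans ha, h2.mono h, (h _ (h2.2.1 0)).trans h3⟩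

theorem leadSign_neg_of (e : SignType) (hx : LeadSign x e) : LeadSign (-x) (-e) := by
  obtain ⟨l, i, h1, h2, h3⟩ := hx
  exact ⟨l, i, h1.trans (signAlt_neg x).symm, h2.neg, by simp [h3]⟩

theorem leadSign_one_or (hx : x ≠ 0) : LeadSign x 1 ∨ LeadSign x (-1) := by
  have hex := exists_isAltSubseq x
  obtain ⟨l, hl⟩ : ∃ l, signAlt x = l + 1 := ⟨signAlt x - 1, by have := signAlt_pos hx; omega⟩
  rw [hl] at hex
  obtain ⟨i, hi⟩ := hex
  rcases h : x (i 0)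
  · exact absurd h (hi.2.1 0)
  · exact Or.inr ⟨l, i, hl.symm, hi, h⟩
  · exact Or.inl ⟨l, i, hl.symm, hi, h⟩

/-- Otherwise the earlier first term could be put in front of the other subsequence, giving a longer
one. Hence the leading sign is well defined. -/
theorem not_leadSign_of_lt {l : ℕ} {i j : Fin (l + 1) → Fin n} (hl : l + 1 = signAlt x)
    (hi : IsAltSubseq x i) (hj : IsAltSubseq x j) (hne : x (i 0) ≠ x (j 0)) : ¬ i 0 < j 0 := by
  intro hlt
  have := (hj.cons (hi.2.1 0) hlt hne).le_signAlt
  omega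

theorem not_leadSign_both : ¬ (LeadSign x 1 ∧ LeadSign x (-1)) := by
  rintro ⟨⟨l, i, hl, hi, hi1⟩, ⟨l', j, hl', hj, hj1⟩⟩
  obtain rfl : l = l' := by omega
  have hne : x (i 0) ≠ x (j 0) := by rw [hi1, hj1]; decide
  rcases lt_trichotomy (i 0) (j 0) with h | h | h
  · exact not_leadSign_of_lt hl hi hj hne h
  · exact hne (by rw [h])
  · exact not_leadSign_of_lt hl hj hi hne.symm h

theorem leadSign_neg (hx : x ≠ 0) : LeadSign (-x) 1 ↔ ¬ LeadSign x 1 := by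
  have h1 := leadSign_one_or hx
  have h2 := not_leadSign_both (x := x)
  have h3 : LeadSign (-x) 1 ↔ LeadSign x (-1) := by
    constructor
    · intro h
      have := leadSign_neg_of 1 h
      rwa [show - -x = x by ext; simp] at this
    · intro h
      exact leadSign_neg_of (-1) h
  tauto

theorem neg_ne_zero_sign {κ : Type*} {x : κ → SignType} (hx : x ≠ 0) : -x ≠ 0 := by
  intro h
  apply hx
  ext a
  have := congrFun h a
  simpa using this

theorem leadSign_iff_of_signAlt_eq (h : SignLe x y) (ha : signAlt x = signAlt y) (hx : x ≠ 0) :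
    LeadSign x 1 ↔ LeadSign y 1 := by
  have hy : y ≠ 0 := by
    rintro rfl
    have := signAlt_pos hx
    rw [ha, signAlt_zero] at this
    omega
  refine ⟨leadSign_mono h ha, fun hy1 => ?_⟩
  by_contra hx1
  have := leadSign_mono h.neg (by rw [signAlt_neg, signAlt_neg, ha]) ((leadSign_neg hx).2 hx1)
  exact (leadSign_neg hy).1 this hy1

end AlternatingSign

/-! ### Rank and sign of a single block. -/

section EdgeFamily

variable {n a : ℕ} {E : Set (Set (Fin n))} {x y : Fin n → SignType}

/-- The positive part of `x` contains a member of `E`. -/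
def HasPos (E : Set (Set (Fin n))) (x : Fin n → SignType) : Prop :=
  ∃ e ∈ E, e ⊆ {i | x i = 1}

theorem HasPos.mono (h : SignLe x y) (hx : HasPos E x) : HasPos E y := by
  obtain ⟨e, he, hs⟩ := hx
  refine ⟨e, he, fun i hi => ?_⟩
  have : x i = 1 := hs hi
  have h2 := h i (by rw [this]; decide)
  exact h2.trans this

/-- Vectors of large alternation number one of whose two sides contains a member of `E`. -/
def IsHigh (E : Set (Set (Fin n))) (a : ℕ) (x : Fin n → SignType) : Prop :=
  a ≤ signAlt x ∧ (HasPos E x ∨ HasPos E (-x))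

/-- High vectors exactly one of whose two sides contains a member of `E`. -/
def IsSingle (E : Set (Set (Fin n))) (a : ℕ) (x : Fin n → SignType) : Prop :=
  IsHigh E a x ∧ ¬ (HasPos E x ∧ HasPos E (-x))

open Classical in
/-- The contribution of a block to the label of a sign vector. -/
noncomputable def blockRank (E : Set (Set (Fin n))) (a : ℕ) (x : Fin n → SignType) : ℕ :=
  if IsHigh E a x then
    if HasPos E x ∧ HasPos E (-x) then signSupp x else min (signSupp x) (a + 1)
  else signAlt x

open Classical in
/-- The sign attached to a block. -/
def blockSign (E : Set (Set (Fin n))) (a : ℕ) (x : Fin n → SignType) : Prop :=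
  if IsSingle E a x then HasPos E x else LeadSign x 1

theorem neg_neg_sign {κ : Type*} (x : κ → SignType) : - -x = x := by ext; simp

theorem IsHigh.mono (h : SignLe x y) (hx : IsHigh E a x) : IsHigh E a y :=
  ⟨hx.1.trans (signAlt_mono h), hx.2.imp (HasPos.mono h) (HasPos.mono h.neg)⟩

theorem isHigh_neg : IsHigh E a (-x) ↔ IsHigh E a x := by
  unfold IsHigh
  rw [signAlt_neg, neg_neg_sign, or_comm (a := HasPos E (-x))]

theorem isSingle_neg : IsSingle E a (-x) ↔ IsSingle E a x := by
  unfold IsSingle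
  rw [isHigh_neg, neg_neg_sign, and_comm (a := HasPos E (-x))]

theorem IsSingle.hasPos_neg (h : IsSingle E a x) : HasPos E (-x) ↔ ¬ HasPos E x := by
  have h1 := h.1.2
  have h2 := h.2
  tauto

theorem IsSingle.hasPos_iff (h : SignLe x y) (hx : IsSingle E a x) (hy : IsSingle E a y) :
    HasPos E x ↔ HasPos E y := by
  have h1 := hx.hasPos_neg
  have h2 := hy.hasPos_neg
  have h3 : HasPos E x → HasPos E y := HasPos.mono h
  have h4 : HasPos E (-x) → HasPos E (-y) := HasPos.mono h.neg
  tauto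

theorem IsSingle.of_le (h : SignLe x y) (hx : IsHigh E a x) (hy : IsSingle E a y) :
    IsSingle E a x :=
  ⟨hx, fun h1 => hy.2 ⟨h1.1.mono h, h1.2.mono h.neg⟩⟩

theorem blockSign_neg (hx : x ≠ 0) : blockSign E a (-x) ↔ ¬ blockSign E a x := by
  unfold blockSign
  by_cases h : IsSingle E a x
  · rw [if_pos h, if_pos (isSingle_neg.2 h)]
    exact h.hasPos_neg
  · rw [if_neg h, if_neg (fun h1 => h (isSingle_neg.1 h1))]
    exact leadSign_neg hx

theorem not_hasPos_zero (hE : ∅ ∉ E) : ¬ HasPos E 0 := by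
  rintro ⟨e, he, hs⟩
  refine hE ?_
  have : e = ∅ := Set.eq_empty_of_forall_notMem fun i hi => by
    have : (0 : SignType) = 1 := hs hi
    exact absurd this (by decide)
  rwa [← this]

theorem blockRank_zero : blockRank E a 0 = 0 := by
  unfold blockRank
  split_ifs <;> simp [signSupp_zero, signAlt_zero]

theorem blockRank_pos (hx : x ≠ 0) : 1 ≤ blockRank E a x := by
  have h1 := signSupp_pos hx
  have h2 := signAlt_pos hx
  unfold blockRank
  split_ifs <;> omega

theorem signAlt_le_of_not_isHigh (hE : ∀ x, a ≤ signAlt x → a < signSupp x →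
      HasPos E x ∨ HasPos E (-x)) (hx : ¬ IsHigh E a x) :
    signAlt x < a ∨ (signAlt x = a ∧ signSupp x = a ∧ ¬ HasPos E x ∧ ¬ HasPos E (-x)) := by
  by_cases h : signAlt x < a
  · exact Or.inl h
  · have h1 : ¬ (HasPos E x ∨ HasPos E (-x)) := fun h2 => hx ⟨by omega, h2⟩
    have h2 : ¬ a < signSupp x := fun h3 => h1 (hE x (by omega) h3)
    have h3 := signAlt_le_signSupp x
    exact Or.inr ⟨by omega, by omega, by tauto⟩

theorem blockRank_low (hx : ¬ IsHigh E a x) : blockRank E a x = signAlt x := if_neg hx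

theorem blockRank_single (hx : IsSingle E a x) : blockRank E a x = min (signSupp x) (a + 1) := by
  rw [blockRank, if_pos hx.1, if_neg hx.2]

theorem blockRank_both (hx : IsHigh E a x) (hs : ¬ IsSingle E a x) :
    blockRank E a x = signSupp x := by
  rw [blockRank, if_pos hx, if_pos]
  by_contra h
  exact hs ⟨hx, h⟩

/-- Becoming high raises the rank strictly. When edges appear on the second side, equal ranks force
equal supports and hence equal vectors. Otherwise the sign persists: the leading sign for low
vectors, the side with the edges for one-sided ones. -/
theorem blockRank_mono (hE : ∀ x, a ≤ signAlt x → a < signSupp x →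
      HasPos E x ∨ HasPos E (-x)) (h : SignLe x y) :
    blockRank E a x ≤ blockRank E a y ∧
      (blockRank E a x = blockRank E a y → x ≠ 0 → (blockSign E a x ↔ blockSign E a y)) := by
  have hs := signSupp_mono h
  have hal := signAlt_mono h
  have hysa := signAlt_le_signSupp y
  have hxsa := signAlt_le_signSupp x
  by_cases hx : IsHigh E a x
  · have hy := hx.mono h
    by_cases hxs : IsSingle E a x
    · rw [blockRank_single hxs]
      by_cases hys : IsSingle E a y
      · rw [blockRank_single hys]
        refine ⟨by omega, fun _ _ => ?_⟩
        rw [blockSign, blockSign, if_pos hxs, if_pos hys]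
        exact hxs.hasPos_iff h hys
      · rw [blockRank_both hy hys]
        refine ⟨by omega, fun h1 _ => ?_⟩
        have := h.eq_of_signSupp_le (by omega)
        rw [this]
    · have hys : ¬ IsSingle E a y := fun h1 => hxs (IsSingle.of_le h hx h1)
      rw [blockRank_both hx hxs, blockRank_both hy hys]
      refine ⟨by omega, fun h1 _ => ?_⟩
      have := h.eq_of_signSupp_le (by omega)
      rw [this]
  · rw [blockRank_low hx]
    by_cases hy : IsHigh E a y
    · have hlt : signAlt x < blockRank E a y := by
        have hya := hy.1
        have : signAlt x < signSupp y ∧ signAlt x < a + 1 := by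
          rcases signAlt_le_of_not_isHigh hE hx with h1 | ⟨h1, h2, _⟩
          · omega
          · refine ⟨?_, by omega⟩
            by_contra h3
            have := h.eq_of_signSupp_le (by omega)
            rw [this] at hx
            exact hx hy
        by_cases hys : IsSingle E a y
        · rw [blockRank_single hys]; omega
        · rw [blockRank_both hy hys]; omega
      exact ⟨by omega, fun h1 => absurd h1 (by omega)⟩
    · rw [blockRank_low hy]
      refine ⟨hal, fun h1 hx0 => ?_⟩
      rw [blockSign, blockSign, if_neg (fun h2 => hx h2.1), if_neg (fun h2 => hy h2.1)]
      exact leadSign_iff_of_signAlt_eq h h1 hx0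

end EdgeFamily

/-! ### Labels of sign vectors on the union of all blocks. -/

section ProductLabels

variable {s t : ℕ} {a : Fin s → ℕ}

/-- The `j`-th block of a sign vector. -/
def block (x : (Σ j, Fin (a j + t)) → SignType) (j : Fin s) : Fin (a j + t) → SignType :=
  fun i => x ⟨j, i⟩

theorem SignLe.block {x y : (Σ j, Fin (a j + t)) → SignType} (h : SignLe x y) (j : Fin s) :
    SignLe (block x j) (block y j) := fun i hi => h ⟨j, i⟩ hi

theorem block_neg (x : (Σ j, Fin (a j + t)) → SignType) (j : Fin s) :
    block (-x) j = -block x j := rfl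

theorem exists_block_ne_zero {x : (Σ j, Fin (a j + t)) → SignType} (hx : x ≠ 0) :
    ∃ j, block x j ≠ 0 := by
  obtain ⟨⟨j, i⟩, hi⟩ := Function.ne_iff.1 hx
  exact ⟨j, Function.ne_iff.2 ⟨i, hi⟩⟩

variable (E : ∀ j, Set (Set (Fin (a j + t)))) (c : (∀ j, Set (Fin (a j + t))) → Fin t)

/-- All blocks contain edges and some sign occurs for all of them. -/
def IsCommon (x : (Σ j, Fin (a j + t)) → SignType) : Prop :=
  (∀ j, IsHigh (E j) (a j) (block x j)) ∧
    ((∀ j, HasPos (E j) (block x j)) ∨ ∀ j, HasPos (E j) (block (-x) j))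

/-- The color `k` is used by a tuple of edges in the positive part of `x`. -/
def IsColorPos (x : (Σ j, Fin (a j + t)) → SignType) (k : Fin t) : Prop :=
  ∃ e : ∀ j, Set (Fin (a j + t)), (∀ j, e j ∈ E j ∧ e j ⊆ {i | block x j i = 1}) ∧ c e = k

open Classical in
/-- The largest color, counted from `1`, of a tuple of edges in one of the two parts of `x`. -/
noncomputable def maxColor (x : (Σ j, Fin (a j + t)) → SignType) : ℕ :=
  (Finset.univ.filter fun k => IsColorPos E c x k ∨ IsColorPos E c (-x) k).sup
    fun k => (k : ℕ) + 1

open Classical in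
/-- The number of blocks with edges on one side only. -/
noncomputable def numSingle (x : (Σ j, Fin (a j + t)) → SignType) : ℕ :=
  (Finset.univ.filter fun j => IsSingle (E j) (a j) (block x j)).card

open Classical in
/-- The label of a sign vector. -/
noncomputable def label (x : (Σ j, Fin (a j + t)) → SignType) : ℕ :=
  if ∃ j, ¬ IsHigh (E j) (a j) (block x j) then ∑ j, blockRank (E j) (a j) (block x j)
  else if IsCommon E x then ∑ j, (a j + t) - t + maxColor E c x
  else ∑ j, (a j + t) - t + 1 - numSingle E x

open Classical in
/-- The sign of the label of a sign vector. -/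
def labelSign (x : (Σ j, Fin (a j + t)) → SignType) : Prop :=
  if ∃ j, ¬ IsHigh (E j) (a j) (block x j) then
    ∃ j, block x j ≠ 0 ∧ (∀ i < j, block x i = 0) ∧ blockSign (E j) (a j) (block x j)
  else if IsCommon E x then ∃ k : Fin t, (k : ℕ) + 1 = maxColor E c x ∧ IsColorPos E c x k
  else ∃ j, IsSingle (E j) (a j) (block x j) ∧ (∀ i < j, ¬ IsSingle (E i) (a i) (block x i)) ∧
    HasPos (E j) (block x j)

variable {E c} {x y : (Σ j, Fin (a j + t)) → SignType}

theorem IsCommon.mono (h : SignLe x y) (hx : IsCommon E x) : IsCommon E y :=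
  ⟨fun j => (hx.1 j).mono (h.block j), hx.2.imp (fun h1 j => (h1 j).mono (h.block j))
    fun h1 j => (h1 j).mono (h.neg.block j)⟩

theorem isCommon_neg : IsCommon E (-x) ↔ IsCommon E x := by
  unfold IsCommon
  simp only [block_neg, isHigh_neg, neg_neg_sign, or_comm]

theorem IsColorPos.mono (h : SignLe x y) {k : Fin t} (hx : IsColorPos E c x k) :
    IsColorPos E c y k := by
  obtain ⟨e, he, hk⟩ := hx
  refine ⟨e, fun j => ⟨(he j).1, fun i hi => ?_⟩, hk⟩
  have h1 : block x j i = 1 := (he j).2 hi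
  have h2 := h.block j i (by rw [h1]; decide)
  exact h2.trans h1

theorem maxColor_neg : maxColor E c (-x) = maxColor E c x := by
  unfold maxColor
  congr 1
  ext k
  simp only [Finset.mem_filter, neg_neg_sign, or_comm]

theorem maxColor_le : maxColor E c x ≤ t := Finset.sup_le fun k _ => k.2

theorem IsCommon.exists_color (h : IsCommon E x) :
    ∃ k, IsColorPos E c x k ∨ IsColorPos E c (-x) k := by
  rcases h.2 with h | h
  · choose e he using h
    exact ⟨c e, Or.inl ⟨e, he, rfl⟩⟩
  · choose e he using h
    exact ⟨c e, Or.inr ⟨e, he, rfl⟩⟩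

theorem IsCommon.exists_maxColor (h : IsCommon E x) :
    ∃ k : Fin t, (k : ℕ) + 1 = maxColor E c x ∧
      (IsColorPos E c x k ∨ IsColorPos E c (-x) k) := by
  classical
  obtain ⟨k0, hk0⟩ := h.exists_color (c := c)
  obtain ⟨k, hk, hk2⟩ := Finset.exists_mem_eq_sup
    (Finset.univ.filter fun k => IsColorPos E c x k ∨ IsColorPos E c (-x) k)
    ⟨k0, by simpa using hk0⟩ (fun k : Fin t => (k : ℕ) + 1)
  exact ⟨k, hk2.symm, by simpa using hk⟩

theorem maxColor_mono (h : SignLe x y) : maxColor E c x ≤ maxColor E c y := by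
  classical
  refine Finset.sup_mono fun k hk => ?_
  simp only [Finset.mem_filter, Finset.mem_univ, true_and] at hk ⊢
  exact hk.imp (IsColorPos.mono h) (IsColorPos.mono h.neg)

/-- `c` colors disjoint tuples of edges differently. -/
def IsProperOn (E : ∀ j, Set (Set (Fin (a j + t)))) (c : (∀ j, Set (Fin (a j + t))) → Fin t) :
    Prop :=
  ∀ e f : ∀ j, Set (Fin (a j + t)), (∀ j, e j ∈ E j) → (∀ j, f j ∈ E j) →
    (∀ j, Disjoint (e j) (f j)) → c e ≠ c f

theorem IsProperOn.not_both (hc : IsProperOn E c) {k : Fin t} :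
    ¬ (IsColorPos E c x k ∧ IsColorPos E c (-x) k) := by
  rintro ⟨⟨e, he, hek⟩, f, hf, hfk⟩
  refine hc e f (fun j => (he j).1) (fun j => (hf j).1) (fun j => ?_) (hek.trans hfk.symm)
  refine Set.disjoint_left.2 fun i hi1 hi2 => ?_
  have h1 : block x j i = 1 := (he j).2 hi1
  have h2 : -block x j i = 1 := (hf j).2 hi2
  rw [h1] at h2
  exact absurd h2 (by decide)

theorem label_low (h : ∃ j, ¬ IsHigh (E j) (a j) (block x j)) :
    label E c x = ∑ j, blockRank (E j) (a j) (block x j) := if_pos h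

theorem not_low (h : ∀ j, IsHigh (E j) (a j) (block x j)) :
    ¬ ∃ j, ¬ IsHigh (E j) (a j) (block x j) := fun ⟨j, hj⟩ => hj (h j)

theorem label_top (h : IsCommon E x) : label E c x = ∑ j, (a j + t) - t + maxColor E c x := by
  rw [label, if_neg (not_low h.1), if_pos h]

theorem label_middle (h : ∀ j, IsHigh (E j) (a j) (block x j)) (h2 : ¬ IsCommon E x) :
    label E c x = ∑ j, (a j + t) - t + 1 - numSingle E x := by
  rw [label, if_neg (not_low h), if_neg h2]

theorem labelSign_low (h : ∃ j, ¬ IsHigh (E j) (a j) (block x j)) :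
    labelSign E c x ↔ ∃ j, block x j ≠ 0 ∧ (∀ i < j, block x i = 0) ∧
      blockSign (E j) (a j) (block x j) := by
  rw [labelSign, if_pos h]

theorem labelSign_top (h : IsCommon E x) : labelSign E c x ↔
    ∃ k : Fin t, (k : ℕ) + 1 = maxColor E c x ∧ IsColorPos E c x k := by
  rw [labelSign, if_neg (not_low h.1), if_pos h]

theorem labelSign_middle (h : ∀ j, IsHigh (E j) (a j) (block x j)) (h2 : ¬ IsCommon E x) :
    labelSign E c x ↔ ∃ j, IsSingle (E j) (a j) (block x j) ∧
      (∀ i < j, ¬ IsSingle (E i) (a i) (block x i)) ∧ HasPos (E j) (block x j) := by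
  rw [labelSign, if_neg (not_low h), if_neg h2]

theorem exists_first {P : Fin s → Prop} (h : ∃ j, P j) : ∃ j, P j ∧ ∀ i < j, ¬ P i := by
  classical
  obtain ⟨j, hj⟩ := h
  obtain ⟨m, hm, hmin⟩ := Finset.exists_minimal (s := Finset.univ.filter P) ⟨j, by simpa using hj⟩
  refine ⟨m, by simpa using hm, fun i hi hPi => ?_⟩
  exact absurd (hmin (by simpa using hPi) hi.le) (not_le.2 hi)

/-- Evaluation of `Q` at the first index satisfying `P`. -/
theorem first_iff {P Q : Fin s → Prop} {j : Fin s} (hj : P j) (hmin : ∀ i < j, ¬ P i) :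
    (∃ i, P i ∧ (∀ l < i, ¬ P l) ∧ Q i) ↔ Q j := by
  refine ⟨?_, fun h => ⟨j, hj, hmin, h⟩⟩
  rintro ⟨i, hi, himin, hQ⟩
  rcases lt_trichotomy i j with h | h | h
  · exact absurd hi (hmin i h)
  · exact h ▸ hQ
  · exact absurd hj (himin j h)

theorem labelSign_low' (h : ∃ j, ¬ IsHigh (E j) (a j) (block x j)) {j : Fin s}
    (hj : block x j ≠ 0) (hmin : ∀ i < j, block x i = 0) :
    labelSign E c x ↔ blockSign (E j) (a j) (block x j) := by
  rw [labelSign_low h, ← first_iff (P := fun j => block x j ≠ 0)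
    (Q := fun j => blockSign (E j) (a j) (block x j)) hj (fun i hi => not_not.2 (hmin i hi))]
  simp

theorem labelSign_middle' (h : ∀ j, IsHigh (E j) (a j) (block x j)) (h2 : ¬ IsCommon E x)
    {j : Fin s} (hj : IsSingle (E j) (a j) (block x j))
    (hmin : ∀ i < j, ¬ IsSingle (E i) (a i) (block x i)) :
    labelSign E c x ↔ HasPos (E j) (block x j) := by
  rw [labelSign_middle h h2]
  exact first_iff (P := fun j => IsSingle (E j) (a j) (block x j))
    (Q := fun j => HasPos (E j) (block x j)) hj hmin

/-- One block lacks a positive edge and one lacks a negative edge; a high block cannot lack both. -/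
theorem exists_single (h : ∀ j, IsHigh (E j) (a j) (block x j)) (h2 : ¬ IsCommon E x) :
    ∃ i j, i ≠ j ∧ IsSingle (E i) (a i) (block x i) ∧ IsSingle (E j) (a j) (block x j) := by
  have h3 : ¬ ∀ j, HasPos (E j) (block x j) := fun h3 => h2 ⟨h, Or.inl h3⟩
  have h4 : ¬ ∀ j, HasPos (E j) (block (-x) j) := fun h3 => h2 ⟨h, Or.inr h3⟩
  push Not at h3 h4
  obtain ⟨i, hi⟩ := h3
  obtain ⟨j, hj⟩ := h4
  refine ⟨i, j, ?_, ⟨h i, fun h => hi h.1⟩, ⟨h j, fun h => hj h.2⟩⟩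
  rintro rfl
  exact (h i).2.elim hi hj

theorem one_lt_numSingle (h : ∀ j, IsHigh (E j) (a j) (block x j)) (h2 : ¬ IsCommon E x) :
    2 ≤ numSingle E x := by
  classical
  obtain ⟨i, j, hij, hi, hj⟩ := exists_single h h2
  exact Finset.one_lt_card.2 ⟨i, by simpa using hi, j, by simpa using hj, hij⟩

theorem labelSign_neg (hc : IsProperOn E c) (hx : x ≠ 0) :
    labelSign E c (-x) ↔ ¬ labelSign E c x := by
  by_cases hlow : ∃ j, ¬ IsHigh (E j) (a j) (block x j)
  · obtain ⟨j, hj, hmin⟩ := exists_first (exists_block_ne_zero hx)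
    simp only [not_not] at hmin
    have hlow' : ∃ j, ¬ IsHigh (E j) (a j) (block (-x) j) := by
      simpa only [block_neg, isHigh_neg] using hlow
    rw [labelSign_low' hlow hj hmin, labelSign_low' hlow' (j := j) (neg_ne_zero_sign hj)
      (fun i hi => by rw [block_neg, hmin i hi]; ext; simp)]
    exact blockSign_neg hj
  · push Not at hlow
    have hlow' : ∀ j, IsHigh (E j) (a j) (block (-x) j) := by
      simpa only [block_neg, isHigh_neg] using hlow
    by_cases htop : IsCommon E x
    · rw [labelSign_top htop, labelSign_top (isCommon_neg.2 htop), maxColor_neg]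
      obtain ⟨k, hk, hkc⟩ := htop.exists_maxColor (c := c)
      have huniq : ∀ l : Fin t, (l : ℕ) + 1 = maxColor E c x → l = k := fun l hl => by
        ext; omega
      have hnb := hc.not_both (x := x) (k := k)
      constructor
      · rintro ⟨l, hl, hlc⟩ ⟨l', hl', hlc'⟩
        rw [huniq l hl] at hlc
        rw [huniq l' hl'] at hlc'
        exact hnb ⟨hlc', hlc⟩
      · intro h
        refine ⟨k, hk, hkc.resolve_left fun h1 => h ⟨k, hk, h1⟩⟩
    · have htop' : ¬ IsCommon E (-x) := fun h => htop (isCommon_neg.1 h)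
      obtain ⟨i, _, _, hi, _⟩ := exists_single hlow htop
      obtain ⟨j, hj, hmin⟩ := exists_first (P := fun j => IsSingle (E j) (a j) (block x j)) ⟨i, hi⟩
      rw [labelSign_middle' hlow htop hj hmin, labelSign_middle' hlow' htop' (j := j)
        (isSingle_neg.2 hj) (fun i hi h => hmin i hi (isSingle_neg.1 h))]
      exact hj.hasPos_neg

theorem blockRank_le (hE : ∀ j, ∀ x, a j ≤ signAlt x → a j < signSupp x →
      HasPos (E j) x ∨ HasPos (E j) (-x)) (ht : 1 ≤ t) (j : Fin s) :
    blockRank (E j) (a j) (block x j) ≤ a j + t := by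
  have := signSupp_le (block x j)
  by_cases h : IsHigh (E j) (a j) (block x j)
  · by_cases h1 : IsSingle (E j) (a j) (block x j)
    · rw [blockRank_single h1]; omega
    · rw [blockRank_both h h1]; omega
  · rw [blockRank_low h]
    rcases signAlt_le_of_not_isHigh (hE j) h with h | h <;> omega

theorem blockRank_add_le_of_low (hE : ∀ j, ∀ x, a j ≤ signAlt x → a j < signSupp x →
      HasPos (E j) x ∨ HasPos (E j) (-x)) {j : Fin s}
    (h : ¬ IsHigh (E j) (a j) (block x j)) :
    blockRank (E j) (a j) (block x j) + t ≤ a j + t := by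
  rw [blockRank_low h]
  rcases signAlt_le_of_not_isHigh (hE j) h with h | h <;> omega

theorem sum_blockRank_add_le (hE : ∀ j, ∀ x, a j ≤ signAlt x → a j < signSupp x →
      HasPos (E j) x ∨ HasPos (E j) (-x)) (ht : 1 ≤ t) {j0 : Fin s}
    (h : ¬ IsHigh (E j0) (a j0) (block x j0)) :
    ∑ j, blockRank (E j) (a j) (block x j) + t ≤ ∑ j, (a j + t) := by
  have h1 : ∑ j, (if j = j0 then t else 0) = t := by simp
  have key : ∑ j, (blockRank (E j) (a j) (block x j) + if j = j0 then t else 0) ≤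
      ∑ j, (a j + t) := by
    refine Finset.sum_le_sum fun j _ => ?_
    split_ifs with hj
    · subst hj
      exact blockRank_add_le_of_low hE h
    · exact blockRank_le hE ht j
  rwa [Finset.sum_add_distrib, h1] at key

/-- This puts the middle labels strictly above the low ones. It is here that t ≥ 3 enters: a
one-sided block has rank at most a_j + 1, which is at least 2 below its maximum. -/
theorem sum_blockRank_add_numSingle_le (hE : ∀ j, ∀ x, a j ≤ signAlt x → a j < signSupp x →
      HasPos (E j) x ∨ HasPos (E j) (-x)) (ht : 3 ≤ t) (hxy : SignLe x y)
    {j0 : Fin s} (h : ¬ IsHigh (E j0) (a j0) (block x j0))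
    (hy : ∀ j, IsHigh (E j) (a j) (block y j)) (hy2 : ¬ IsCommon E y) :
    ∑ j, blockRank (E j) (a j) (block x j) + t + numSingle E y ≤ ∑ j, (a j + t) := by
  classical
  have h1 : ∑ j, (if j = j0 then t else 0) = t := by simp
  have h2 : ∑ j : Fin s, (if j = j0 then 2 else 0) = 2 := by simp
  have h3 : ∑ j, (if IsSingle (E j) (a j) (block y j) then 2 else 0) = numSingle E y * 2 := by
    rw [← Finset.sum_filter, Finset.sum_const, smul_eq_mul, numSingle]
  have h4 := one_lt_numSingle hy hy2
  -- The block `j0` may itself be one-sided in `y`, so 2 is allowed back there. The surplus is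
  -- absorbed because at least two blocks are one-sided.
  have key : ∑ j, (blockRank (E j) (a j) (block x j) + (if j = j0 then t else 0) +
      (if IsSingle (E j) (a j) (block y j) then 2 else 0)) ≤
      ∑ j, ((a j + t) + (if j = j0 then 2 else 0)) := by
    refine Finset.sum_le_sum fun j _ => ?_
    by_cases hx : IsHigh (E j) (a j) (block x j)
    · have hj : j ≠ j0 := by rintro rfl; exact h hx
      rw [if_neg hj, if_neg hj]
      split_ifs with hs
      · rw [blockRank_single (IsSingle.of_le (hxy.block j) hx hs)]
        omega
      · have := blockRank_le (x := x) hE (by omega) j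
        omega
    · have := blockRank_add_le_of_low hE hx
      split_ifs <;> omega
  simp only [Finset.sum_add_distrib] at key ⊢
  rw [h1, h2, h3] at key
  omega

/-- Low, middle and common vectors occupy successive ranges. Within them, block ranks grow,
one-sided blocks can only become two-sided, and the largest color grows. Equality preserves the
block or color that determines the sign. -/
theorem label_mono (hE : ∀ j, ∀ x, a j ≤ signAlt x → a j < signSupp x →
      HasPos (E j) x ∨ HasPos (E j) (-x)) (hc : IsProperOn E c) (ht : 1 ≤ t)
    (hst : 3 ≤ t ∨ s = 1) (h0 : 0 < s) (hxy : SignLe x y) :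
    label E c x ≤ label E c y ∧
      (label E c x = label E c y → x ≠ 0 → (labelSign E c x ↔ labelSign E c y)) := by
  by_cases hlow : ∃ j, ¬ IsHigh (E j) (a j) (block y j)
  · have hlowx : ∃ j, ¬ IsHigh (E j) (a j) (block x j) :=
      hlow.imp fun j hj h => hj (h.mono (hxy.block j))
    rw [label_low hlow, label_low hlowx]
    have hle : ∀ j ∈ Finset.univ, blockRank (E j) (a j) (block x j) ≤
        blockRank (E j) (a j) (block y j) :=
      fun j _ => (blockRank_mono (hE j) (hxy.block j)).1
    refine ⟨Finset.sum_le_sum hle, fun heq hx => ?_⟩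
    have heq' := (Finset.sum_eq_sum_iff_of_le hle).1 heq
    -- Equal ranks keep zero blocks zero, so the first nonzero block is the same.
    have hz : ∀ j, block x j = 0 → block y j = 0 := fun j hj => by
      by_contra hne
      have h1 := blockRank_pos (E := E j) (a := a j) hne
      have h2 := heq' j (Finset.mem_univ j)
      rw [hj, blockRank_zero] at h2
      omega
    obtain ⟨j, hj, hmin⟩ := exists_first (exists_block_ne_zero hx)
    simp only [not_not] at hmin
    have hyj : block y j ≠ 0 := by
      obtain ⟨i, hi⟩ := Function.ne_iff.1 hj
      exact Function.ne_iff.2 ⟨i, by rw [hxy.block j i hi]; exact hi⟩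
    rw [labelSign_low' hlowx hj hmin, labelSign_low' hlow hyj (fun i hi => hz i (hmin i hi))]
    exact (blockRank_mono (hE j) (hxy.block j)).2 (heq' j (Finset.mem_univ j)) hj
  · push Not at hlow
    by_cases hlowx : ∃ j, ¬ IsHigh (E j) (a j) (block x j)
    · have hlt : label E c x < label E c y := by
        rw [label_low hlowx]
        obtain ⟨j0, hj0⟩ := hlowx
        by_cases hy : IsCommon E y
        · have h1 := sum_blockRank_add_le hE ht hj0
          rw [label_top hy]
          obtain ⟨k, hk, _⟩ := hy.exists_maxColor (c := c)
          omega
        · rw [label_middle hlow hy]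
          rcases hst with h3 | rfl
          · have := sum_blockRank_add_numSingle_le hE h3 hxy hj0 hlow hy
            omega
          · obtain ⟨i, j, hij, _⟩ := exists_single hlow hy
            exact absurd (Subsingleton.elim i j) hij
      exact ⟨hlt.le, fun h => absurd h hlt.ne⟩
    · push Not at hlowx
      by_cases hx : IsCommon E x
      · have hy := hx.mono hxy
        rw [label_top hx, label_top hy]
        refine ⟨by have := maxColor_mono (E := E) (c := c) hxy; omega, fun h _ => ?_⟩
        have hmax : maxColor E c x = maxColor E c y := by omega
        rw [labelSign_top hx, labelSign_top hy, ← hmax]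
        refine ⟨fun ⟨k, hk, h1⟩ => ⟨k, hk, h1.mono hxy⟩, fun ⟨k, hk, h1⟩ => ?_⟩
        obtain ⟨k', hk', h2⟩ := hx.exists_maxColor (c := c)
        obtain rfl : k = k' := by ext; omega
        exact ⟨k, hk, h2.resolve_right fun h3 => hc.not_both ⟨h1, h3.mono hxy.neg⟩⟩
      · rw [label_middle hlowx hx]
        classical
        have hsub : (Finset.univ.filter fun j => IsSingle (E j) (a j) (block y j)) ⊆
            Finset.univ.filter fun j => IsSingle (E j) (a j) (block x j) := by
          intro j hj
          simp only [Finset.mem_filter, Finset.mem_univ, true_and] at hj ⊢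
          exact hj.of_le (hxy.block j) (hlowx j)
        have hcard : numSingle E y ≤ numSingle E x := by
          unfold numSingle
          exact Finset.card_le_card hsub
        have h2 := one_lt_numSingle hlowx hx
        by_cases hy : IsCommon E y
        · rw [label_top hy]
          obtain ⟨k, hk, _⟩ := hy.exists_maxColor (c := c)
          exact ⟨by omega, fun h => absurd h (by omega)⟩
        · rw [label_middle hlow hy]
          refine ⟨by omega, fun h _ => ?_⟩
          have h2y := one_lt_numSingle hlow hy
          -- Without truncation in the subtraction, equal labels give equally many one-sided blocks.
          have hbound : numSingle E x ≤ ∑ j, (a j + t) - t + 1 := by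
            rcases hst with h3 | rfl
            · have h5 : numSingle E x ≤ s := by
                unfold numSingle
                exact (Finset.card_le_univ _).trans_eq (Fintype.card_fin s)
              have h6 : s * t ≤ ∑ j, (a j + t) := by
                rw [Finset.sum_add_distrib]
                simp
              obtain ⟨r, rfl⟩ : ∃ r, s = r + 1 := ⟨s - 1, by omega⟩
              have h7 : r * 1 ≤ r * t := Nat.mul_le_mul_left r (by omega)
              rw [add_mul] at h6
              omega
            · obtain ⟨i, j, hij, _⟩ := exists_single hlow hy
              exact absurd (Subsingleton.elim i j) hij
          have heq : numSingle E y = numSingle E x := by omega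
          have hseteq := Finset.eq_of_subset_of_card_le hsub (by
            unfold numSingle at heq
            exact heq.ge)
          have hiff : ∀ j, IsSingle (E j) (a j) (block y j) ↔
              IsSingle (E j) (a j) (block x j) := fun j => by
            have := Finset.ext_iff.1 hseteq j
            simpa using this
          obtain ⟨i, _, _, hi, _⟩ := exists_single hlowx hx
          obtain ⟨j, hj, hmin⟩ :=
            exists_first (P := fun j => IsSingle (E j) (a j) (block x j)) ⟨i, hi⟩
          rw [labelSign_middle' hlowx hx hj hmin, labelSign_middle' hlow hy ((hiff j).2 hj)
            (fun i hi h => hmin i hi ((hiff i).1 h))]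
          exact hj.hasPos_iff (hxy.block j) ((hiff j).2 hj)

end ProductLabels

/-! ### Critical vectors and the colorful tuples of edges. -/

section StarBipartite

open Function

variable {s t : ℕ} {a : Fin s → ℕ} {E : ∀ j, Set (Set (Fin (a j + t)))}
  {c : (∀ j, Set (Fin (a j + t))) → Fin t} {x y z : (Σ j, Fin (a j + t)) → SignType}

theorem block_zero (j : Fin s) : block (0 : (Σ j, Fin (a j + t)) → SignType) j = 0 := rfl

theorem not_isHigh_zero (hE0 : ∀ j, ∅ ∉ E j) (j : Fin s) :
    ¬ IsHigh (E j) (a j) (block (0 : (Σ j, Fin (a j + t)) → SignType) j) := by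
  intro h
  have h1 := not_hasPos_zero (hE0 j)
  rcases h.2 with h | h
  · exact h1 h
  · rw [block_zero, show -(0 : Fin (a j + t) → SignType) = 0 by ext; simp] at h
    exact h1 h

theorem label_zero (hE0 : ∀ j, ∅ ∉ E j) (h0 : 0 < s) :
    label E c (0 : (Σ j, Fin (a j + t)) → SignType) = 0 := by
  rw [label_low ⟨⟨0, h0⟩, not_isHigh_zero hE0 _⟩]
  exact Finset.sum_eq_zero fun j _ => by rw [block_zero, blockRank_zero]

theorem signLe_zero (x : (Σ j, Fin (a j + t)) → SignType) : SignLe 0 x :=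
  fun _ h => absurd rfl h

theorem add_numSingle_le (hE0 : ∀ j, ∅ ∉ E j)
    (hE : ∀ j, ∀ x, a j ≤ signAlt x → a j < signSupp x → HasPos (E j) x ∨ HasPos (E j) (-x))
    (hst : 3 ≤ t ∨ s = 1) (h0 : 0 < s)
    (hx : ∀ j, IsHigh (E j) (a j) (block x j)) (hx2 : ¬ IsCommon E x) :
    t + numSingle E x ≤ ∑ j, (a j + t) := by
  rcases hst with ht | rfl
  · have := sum_blockRank_add_numSingle_le hE ht (signLe_zero x)
      (not_isHigh_zero hE0 ⟨0, h0⟩) hx hx2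
    omega
  · obtain ⟨i, j, hij, _⟩ := exists_single hx hx2
    exact absurd (Subsingleton.elim i j) hij

theorem le_sum_add (h0 : 0 < s) : t ≤ ∑ j : Fin s, (a j + t) := by
  have := Finset.single_le_sum (f := fun j : Fin s => a j + t) (fun _ _ => Nat.zero_le _)
    (Finset.mem_univ ⟨0, h0⟩)
  omega

theorem label_le_of_not_isCommon
    (hE : ∀ j, ∀ x, a j ≤ signAlt x → a j < signSupp x → HasPos (E j) x ∨ HasPos (E j) (-x))
    (ht : 1 ≤ t) (hx : ¬ IsCommon E x) :
    label E c x ≤ ∑ j, (a j + t) - t := by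
  by_cases h : ∃ j, ¬ IsHigh (E j) (a j) (block x j)
  · rw [label_low h]
    obtain ⟨j, hj⟩ := h
    have := sum_blockRank_add_le hE ht hj
    omega
  · push Not at h
    rw [label_middle h hx]
    have := one_lt_numSingle h hx
    omega

theorem lt_label_of_isCommon (hx : IsCommon E x) : ∑ j, (a j + t) - t < label E c x := by
  rw [label_top hx]
  obtain ⟨k, hk, _⟩ := hx.exists_maxColor (c := c)
  omega

theorem label_le
    (hE : ∀ j, ∀ x, a j ≤ signAlt x → a j < signSupp x → HasPos (E j) x ∨ HasPos (E j) (-x))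
    (ht : 1 ≤ t) (h0 : 0 < s) : label E c x ≤ ∑ j, (a j + t) := by
  by_cases hx : IsCommon E x
  · rw [label_top hx]
    have h1 := maxColor_le (E := E) (c := c) (x := x)
    have h2 := le_sum_add (t := t) (a := a) h0
    omega
  · exact (label_le_of_not_isCommon hE ht hx).trans (Nat.sub_le _ _)

theorem label_pos (hE0 : ∀ j, ∅ ∉ E j)
    (hE : ∀ j, ∀ x, a j ≤ signAlt x → a j < signSupp x → HasPos (E j) x ∨ HasPos (E j) (-x))
    (hst : 3 ≤ t ∨ s = 1) (h0 : 0 < s) (hx : x ≠ 0) : 1 ≤ label E c x := by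
  by_cases h : ∃ j, ¬ IsHigh (E j) (a j) (block x j)
  · rw [label_low h]
    obtain ⟨j, hj⟩ := exists_block_ne_zero hx
    exact (blockRank_pos hj).trans (Finset.single_le_sum
      (f := fun j => blockRank (E j) (a j) (block x j)) (fun _ _ => Nat.zero_le _)
      (Finset.mem_univ j))
  · push Not at h
    by_cases h2 : IsCommon E x
    · have := lt_label_of_isCommon (c := c) h2
      omega
    · rw [label_middle h h2]
      have := add_numSingle_le hE0 hE hst h0 h h2
      omega

/-- All blocks of `z` but the `j`-th are full and have edges on both sides; the `j`-th is a
longest alternating vector without edges. -/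
def IsCritical (E : ∀ j, Set (Set (Fin (a j + t)))) (z : (Σ j, Fin (a j + t)) → SignType)
    (j : Fin s) : Prop :=
  (signAlt (block z j) = a j ∧ signSupp (block z j) = a j ∧ ¬ HasPos (E j) (block z j) ∧
    ¬ HasPos (E j) (-block z j)) ∧
  ∀ i ≠ j, signSupp (block z i) = a i + t ∧ a i ≤ signAlt (block z i) ∧
    HasPos (E i) (block z i) ∧ HasPos (E i) (-block z i)

theorem IsCritical.neg {j : Fin s} (h : IsCritical E z j) : IsCritical E (-z) j := by
  refine ⟨?_, fun i hi => ?_⟩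
  · rw [block_neg, signAlt_neg, signSupp_neg, neg_neg_sign]
    exact ⟨h.1.1, h.1.2.1, h.1.2.2.2, h.1.2.2.1⟩
  · rw [block_neg, signSupp_neg, signAlt_neg, neg_neg_sign]
    exact ⟨(h.2 i hi).1, (h.2 i hi).2.1, (h.2 i hi).2.2.2, (h.2 i hi).2.2.1⟩

/-- Middle labels are below N - t and common ones above it, so z is low, and every blockwise
estimate is an equality. For another block this excludes being one-sided. -/
theorem exists_isCritical (hE0 : ∀ j, ∅ ∉ E j)
    (hE : ∀ j, ∀ x, a j ≤ signAlt x → a j < signSupp x → HasPos (E j) x ∨ HasPos (E j) (-x))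
    (ht : 1 ≤ t) (hst : 3 ≤ t ∨ s = 1) (h0 : 0 < s)
    (hz : label E c z = ∑ j, (a j + t) - t) : ∃ j, IsCritical E z j := by
  have hN := le_sum_add (t := t) (a := a) h0
  by_cases h : ∃ j, ¬ IsHigh (E j) (a j) (block z j)
  · rw [label_low h] at hz
    obtain ⟨j0, hj0⟩ := h
    have hle : ∀ j ∈ Finset.univ, blockRank (E j) (a j) (block z j) + (if j = j0 then t else 0) ≤
        a j + t := by
      intro j _
      split_ifs with hj
      · subst hj
        exact blockRank_add_le_of_low hE hj0
      · exact blockRank_le hE ht j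
    have heq := (Finset.sum_eq_sum_iff_of_le hle).1 (by
      rw [Finset.sum_add_distrib, hz]
      simp only [Finset.sum_ite_eq', Finset.mem_univ, if_true]
      omega)
    refine ⟨j0, ?_, fun j hj => ?_⟩
    · have h1 := heq j0 (Finset.mem_univ _)
      rw [if_pos rfl, blockRank_low hj0] at h1
      rcases signAlt_le_of_not_isHigh (hE j0) hj0 with h2 | h2
      · omega
      · exact h2
    · have h1 := heq j (Finset.mem_univ _)
      rw [if_neg hj] at h1
      by_cases hh : IsHigh (E j) (a j) (block z j)
      · by_cases hs : IsSingle (E j) (a j) (block z j)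
        · rw [blockRank_single hs] at h1
          rcases hst with h3 | rfl
          · omega
          · exact absurd (Subsingleton.elim j j0) hj
        · rw [blockRank_both hh hs] at h1
          refine ⟨h1, hh.1, ?_⟩
          by_contra h4
          exact hs ⟨hh, h4⟩
      · have := blockRank_add_le_of_low hE hh
        omega
  · push Not at h
    by_cases h2 : IsCommon E z
    · have := lt_label_of_isCommon (c := c) h2
      omega
    · rw [label_middle h h2] at hz
      have h3 := add_numSingle_le hE0 hE hst h0 h h2
      have h4 := one_lt_numSingle h h2
      omega

/-- The other blocks are full, so block j must grow. By niceness it then contains an edge on some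
side, and the other blocks have edges on both. -/
theorem IsCritical.isCommon
    (hE : ∀ j, ∀ x, a j ≤ signAlt x → a j < signSupp x → HasPos (E j) x ∨ HasPos (E j) (-x))
    {j : Fin s} (h : IsCritical E z j) (hzy : SignLe z y) (hne : z ≠ y) :
    IsCommon E y := by
  have hnej : block z j ≠ block y j := by
    intro heq
    apply hne
    ext ⟨i, l⟩
    by_cases hi : i = j
    · subst hi
      exact congrFun heq l
    · exact congrFun ((hzy.block i).eq_of_signSupp_le
        ((signSupp_le _).trans_eq (h.2 i hi).1.symm)) l
  have hsupp : a j < signSupp (block y j) := by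
    by_contra hle
    exact hnej ((hzy.block j).eq_of_signSupp_le (by rw [h.1.2.1]; omega))
  have halt : a j ≤ signAlt (block y j) := h.1.1.ge.trans (signAlt_mono (hzy.block j))
  have hj := hE j _ halt hsupp
  have hpos : ∀ i ≠ j, HasPos (E i) (block y i) := fun i hi => (h.2 i hi).2.2.1.mono (hzy.block i)
  have hneg : ∀ i ≠ j, HasPos (E i) (block (-y) i) :=
    fun i hi => (h.2 i hi).2.2.2.mono (hzy.block i).neg
  have hhigh : ∀ i, HasPos (E i) (block y i) ∨ HasPos (E i) (-block y i) := by
    intro i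
    by_cases hi : i = j
    · subst hi; exact hj
    · exact Or.inl (hpos i hi)
  refine ⟨fun i => ⟨?_, hhigh i⟩, ?_⟩
  · by_cases hi : i = j
    · subst hi; exact halt
    · exact (h.2 i hi).2.1.trans (signAlt_mono (hzy.block i))
  · refine hj.imp (fun h1 i => ?_) fun h1 i => ?_
    · by_cases hi : i = j
      · subst hi; exact h1
      · exact hpos i hi
    · by_cases hi : i = j
      · subst hi; exact h1
      · exact hneg i hi

theorem isColorPos_of_isCommon (hx : IsCommon E x) {k : Fin t}
    (hk : (k : ℕ) + 1 = maxColor E c x) :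
    (labelSign E c x → IsColorPos E c x k) ∧ (¬ labelSign E c x → IsColorPos E c (-x) k) := by
  rw [labelSign_top hx]
  constructor
  · rintro ⟨l, hl, h⟩
    obtain rfl : l = k := by ext; omega
    exact h
  · intro h
    obtain ⟨l, hl, h1⟩ := hx.exists_maxColor (c := c)
    obtain rfl : l = k := by ext; omega
    exact h1.resolve_left fun h2 => h ⟨l, hl, h2⟩

/-- The colors can be split between the two sides of vectors above `z` in every possible way. -/
def HasAllSplits (E : ∀ j, Set (Set (Fin (a j + t)))) (c : (∀ j, Set (Fin (a j + t))) → Fin t)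
    (z : (Σ j, Fin (a j + t)) → SignType) : Prop :=
  ∀ T : Fin t → Prop, ∃ y, SignLe z y ∧
    ∀ k, (T k → IsColorPos E c y k) ∧ (¬ T k → IsColorPos E c (-y) k)

theorem HasAllSplits.neg (h : HasAllSplits E c z) : HasAllSplits E c (-z) := by
  intro T
  obtain ⟨y, hy, hT⟩ := h fun k => ¬ T k
  refine ⟨-y, hy.neg, fun k => ⟨fun hk => (hT k).2 (not_not.2 hk), fun hk => ?_⟩⟩
  rw [neg_neg_sign]
  exact (hT k).1 hk

theorem signCovers_signLe (h : SignCovers x y) : SignLe x y := fun _ ha => h.eq_of_ne_zero ha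

theorem SignCovers.ne (h : SignCovers x y) : x ≠ y := by
  obtain ⟨b, hb, e, he, rfl⟩ := h
  intro h1
  have := congrFun h1 b
  rw [update_self, hb] at this
  exact he this.symm

/-- Fan's lemma is applied with j = t. A chain vector of label N - t + k + 1 shows on which side
color k occurs, and the top of the chain inherits all these occurrences. -/
theorem exists_isCritical_hasAllSplits (hE0 : ∀ j, ∅ ∉ E j)
    (hE : ∀ j, ∀ x, a j ≤ signAlt x → a j < signSupp x → HasPos (E j) x ∨ HasPos (E j) (-x))
    (hc : IsProperOn E c) (ht : 1 ≤ t) (hst : 3 ≤ t ∨ s = 1) (h0 : 0 < s) :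
    ∃ z j, IsCritical E z j ∧ HasAllSplits E c z := by
  have hN := le_sum_add (t := t) (a := a) h0
  have hm : ∀ x y : (Σ j, Fin (a j + t)) → SignType, SignCovers x y →
      label E c x ≤ label E c y ∧
        (label E c x = label E c y → (labelSign E c x ↔ labelSign E c y)) := by
    intro x y hxy
    have h1 := label_mono hE hc ht hst h0 (signCovers_signLe hxy)
    refine ⟨h1.1, fun h2 => ?_⟩
    by_cases hx : x = 0
    · subst hx
      have := label_pos (c := c) hE0 hE hst h0 hxy.ne.symm
      rw [← h2, label_zero hE0 h0] at this
      omega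
    · exact h1.2 h2 hx
  obtain ⟨z, hz, hT⟩ := exists_all_patterns (N := ∑ j, (a j + t)) (m := label E c)
    (sg := labelSign E c) (by simp) (fun x => label_le hE ht h0) hm
    (fun x hx => label_pos hE0 hE hst h0 hx) (fun x hx => labelSign_neg hc hx) hN
    (fun z hz y hy => by
      obtain ⟨j, hj⟩ := exists_isCritical hE0 hE ht hst h0 hz
      exact lt_label_of_isCommon (hj.isCommon hE (signCovers_signLe hy) hy.ne))
  obtain ⟨j, hj⟩ := exists_isCritical hE0 hE ht hst h0 hz
  refine ⟨z, j, hj, fun T => ?_⟩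
  generalize hS : ∑ j, (a j + t) = N at hT hN
  obtain ⟨y, hy, hu⟩ := hT fun m => ∃ k : Fin t, N - t + (k + 1) = m ∧ T k
  refine ⟨y, hy, fun k => ?_⟩
  -- Colors start at 0, so color `k` belongs to the label N - r with r = t - (k + 1).
  obtain ⟨r, hr⟩ : ∃ r, r + ((k : ℕ) + 1) = t := ⟨t - (k + 1), Nat.sub_add_cancel k.2⟩
  obtain ⟨u, _, huy, hlab, hsg⟩ := hu r (by omega)
  have h2 : labelSign E c u ↔ T k := by
    refine hsg.trans ?_
    clear hsg
    constructor
    · rintro ⟨l, hl, h⟩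
      obtain rfl : l = k := by ext; omega
      exact h
    · intro h
      exact ⟨k, by omega, h⟩
  clear hsg
  have hcom : IsCommon E u := by
    by_contra h
    have := label_le_of_not_isCommon (c := c) hE ht h
    rw [hS] at this
    omega
  have huy' : SignLe u y := huy
  have hmax : (k : ℕ) + 1 = maxColor E c u := by
    rw [label_top hcom, hS] at hlab
    omega
  have h1 := isColorPos_of_isCommon hcom hmax
  exact ⟨fun h => (h1.1 (h2.2 h)).mono huy', fun h => (h1.2 fun h3 => h (h2.1 h3)).mono huy'.neg⟩

theorem signLe_update {κ : Type*} [DecidableEq κ] {z : κ → SignType} {q : κ} (hq : z q = 0)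
    (e : SignType) : SignLe z (update z q e) := by
  intro b hb
  rw [update_of_ne]
  rintro rfl
  exact hb hq

/-- In block j some side acquires an edge. A negative edge would avoid the new positive entry and so
already lie in z. -/
theorem IsCritical.hasPos_update
    (hE : ∀ j, ∀ x, a j ≤ signAlt x → a j < signSupp x → HasPos (E j) x ∨ HasPos (E j) (-x))
    {j : Fin s} (h : IsCritical E z j) {q : Σ j, Fin (a j + t)} (hq : z q = 0) (i : Fin s) :
    HasPos (E i) (block (update z q 1) i) := by
  have hle := signLe_update hq 1
  by_cases hi : i = j
  · subst hi
    have hcom := h.isCommon hE hle (by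
      intro h1
      have := congrFun h1 q
      rw [hq, update_self] at this
      exact absurd this (by decide))
    refine (hcom.1 i).2.resolve_right ?_
    rintro ⟨e, he, hs⟩
    refine h.1.2.2.2 ⟨e, he, fun l hl => ?_⟩
    have h1 : -update z q 1 ⟨i, l⟩ = 1 := hs hl
    have hne : (⟨i, l⟩ : Σ j, Fin (a j + t)) ≠ q := by
      intro hlq
      rw [hlq, update_self] at h1
      exact absurd h1 (by decide)
    rw [update_of_ne hne] at h1
    exact h1
  · exact (h.2 i hi).2.2.1.mono (hle.block i)

theorem IsCritical.exists_zeros {j : Fin s} (h : IsCritical E z j) :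
    ∃ q : Fin t → Σ j, Fin (a j + t), Injective q ∧ ∀ b, z b = 0 ↔ ∃ l, q l = b := by
  have hcard : (Finset.univ.filter fun i => block z j i = 0).card = t := by
    have h1 := Finset.card_filter_add_card_filter_not (s := Finset.univ)
      (fun i => block z j i = 0)
    rw [Finset.card_univ, Fintype.card_fin] at h1
    have h2 : (Finset.univ.filter fun i => ¬ block z j i = 0).card = a j := h.1.2.1
    omega
  set p := (Finset.univ.filter fun i => block z j i = 0).orderEmbOfFin hcard with hp
  refine ⟨fun l => ⟨j, p l⟩, fun l m hlm => ?_, ?_⟩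
  · simpa using hlm
  · rintro ⟨i, l⟩
    constructor
    · intro hz
      by_cases hi : i = j
      · subst hi
        have : l ∈ Set.range p := by
          rw [hp, Finset.range_orderEmbOfFin]
          exact Finset.mem_coe.2 (Finset.mem_filter.2 ⟨Finset.mem_univ _, hz⟩)
        obtain ⟨m, hm⟩ := this
        exact ⟨m, by simp only [hm]⟩
      · exfalso
        have h1 : (Finset.univ.filter fun l => block z i l ≠ 0).card =
            Fintype.card (Fin (a i + t)) := by
          rw [Fintype.card_fin]
          exact (h.2 i hi).1
        have h2 := (Finset.card_eq_iff_eq_univ _).1 h1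
        have h3 := Finset.mem_univ l
        rw [← h2] at h3
        exact (Finset.mem_filter.1 h3).2 hz
    · rintro ⟨m, hm⟩
      rw [← hm]
      have : p m ∈ Finset.univ.filter fun i => block z j i = 0 :=
        Finset.orderEmbOfFin_mem _ hcard m
      exact (Finset.mem_filter.1 this).2

/-- Take y above z with color k positive and all others negative. If no A_l had color k, no zero of
z could become + in y, so a tuple of color k would lie in the positive part of z itself. -/
theorem HasAllSplits.surjective (hc : IsProperOn E c) (h : HasAllSplits E c z)
    (hz : ¬ ∀ j, HasPos (E j) (block z j)) {q : Fin t → Σ j, Fin (a j + t)}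
    (hq : ∀ b, z b = 0 ↔ ∃ l, q l = b) {A : Fin t → ∀ j, Set (Fin (a j + t))}
    (hA : ∀ l j, A l j ∈ E j ∧ A l j ⊆ {i | block (update z (q l) 1) j i = 1}) :
    Surjective fun l => c (A l) := by
  intro k
  by_contra! hk
  obtain ⟨y, hzy, hy⟩ := h fun k' => k' = k
  have hyq : ∀ l, y (q l) ≠ 1 := by
    intro l hl
    have hle : SignLe (update z (q l) 1) y := by
      intro b hb
      by_cases hbq : b = q l
      · rw [hbq, update_self, hl]
      · rw [update_of_ne hbq] at hb ⊢
        exact hzy b hb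
    have h1 : IsColorPos E c (update z (q l) 1) (c (A l)) := ⟨A l, hA l, rfl⟩
    exact hc.not_both ⟨h1.mono hle, (hy (c (A l))).2 (hk l)⟩
  obtain ⟨e, he, _⟩ := (hy k).1 rfl
  refine hz fun j => ⟨e j, (he j).1, fun i hi => ?_⟩
  have h1 : y ⟨j, i⟩ = 1 := (he j).2 hi
  have h2 : z ⟨j, i⟩ ≠ 0 := by
    intro h0
    obtain ⟨l, hl⟩ := (hq _).1 h0
    rw [← hl] at h1
    exact hyq l h1
  exact (hzy _ h2).symm.trans h1

/-- The colorful complete bipartite graph without a perfect matching, in terms of tuples of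
edges. -/
theorem exists_colorful_tuples (hE0 : ∀ j, ∅ ∉ E j) (hE1 : ∀ j i, {i} ∉ E j)
    (hE : ∀ j, ∀ x, a j ≤ signAlt x → a j < signSupp x → HasPos (E j) x ∨ HasPos (E j) (-x))
    (hc : IsProperOn E c) (ht : 1 ≤ t) (hst : 3 ≤ t ∨ s = 1) (h0 : 0 < s) :
    ∃ A B : Fin t → ∀ j, Set (Fin (a j + t)), (∀ l j, A l j ∈ E j) ∧ (∀ l j, B l j ∈ E j) ∧
      (∀ l m, l ≠ m → ∀ j, Disjoint (A l j) (B m j)) ∧ (∀ l, A l ≠ B l) ∧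
      (Surjective fun l => c (A l)) ∧ Surjective fun l => c (B l) := by
  obtain ⟨z, j0, hz, hs⟩ := exists_isCritical_hasAllSplits hE0 hE hc ht hst h0
  obtain ⟨q, hqi, hq⟩ := hz.exists_zeros
  have hq0 : ∀ l, z (q l) = 0 := fun l => (hq _).2 ⟨l, rfl⟩
  have hqn : ∀ b, (-z) b = 0 ↔ ∃ l, q l = b := fun b => by rw [← hq]; simp
  choose A hA using fun l j => hz.hasPos_update hE (hq0 l) j
  choose B hB using fun l j => hz.neg.hasPos_update hE ((hqn (q l)).2 ⟨l, rfl⟩) j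
  -- A_l uses positive entries of `z` and `q l`, while B_m uses negative entries of `z` and `q m`.
  have hinter : ∀ l m j i, i ∈ A l j → i ∈ B m j → l = m ∧ ⟨j, i⟩ = q l := by
    intro l m j i hi1 hi2
    have h1 : update z (q l) 1 ⟨j, i⟩ = 1 := (hA l j).2 hi1
    have h2 : update (-z) (q m) 1 ⟨j, i⟩ = 1 := (hB m j).2 hi2
    by_cases hl : (⟨j, i⟩ : Σ j, Fin (a j + t)) = q l
    · refine ⟨?_, hl⟩
      by_contra hlm
      rw [hl, update_of_ne (fun h => hlm (hqi h))] at h2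
      simp [hq0] at h2
    · exfalso
      rw [update_of_ne hl] at h1
      by_cases hm : (⟨j, i⟩ : Σ j, Fin (a j + t)) = q m
      · rw [hm, hq0] at h1
        exact absurd h1 (by decide)
      · rw [update_of_ne hm, Pi.neg_apply, h1] at h2
        exact absurd h2 (by decide)
  refine ⟨A, B, fun l j => (hA l j).1, fun l j => (hB l j).1, fun l m hlm j => ?_, fun l h => ?_,
    hs.surjective hc (fun h => hz.1.2.2.1 (h j0)) hq hA,
    hs.neg.surjective hc (fun h => hz.1.2.2.2 (h j0)) hqn hB⟩
  · exact Set.disjoint_left.2 fun i hi1 hi2 => hlm (hinter l m j i hi1 hi2).1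
  -- If A_l = B_l, its component in block `j0` would be a single vertex.
  · have h1 : ∀ i ∈ A l j0, (⟨j0, i⟩ : Σ j, Fin (a j + t)) = q l := fun i hi =>
      (hinter l l j0 i hi (h ▸ hi)).2
    have hne : (A l j0).Nonempty := by
      rw [Set.nonempty_iff_ne_empty]
      intro he
      exact hE0 j0 (he ▸ (hA l j0).1)
    obtain ⟨i, hi⟩ := hne
    have : A l j0 = {i} := by
      refine Set.eq_singleton_iff_unique_mem.2 ⟨hi, fun i' hi' => ?_⟩
      have := (h1 i' hi').trans (h1 i hi).symm
      simpa using this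
    exact hE1 j0 i (this ▸ (hA l j0).1)

end StarBipartite

/-! ### Restriction of nice hypergraphs, and small numbers of colors. -/

section NiceHypergraphs

open Function

/-- A sign vector on the first entries, continued by zeros. -/
def extendZero {m n : ℕ} (x : Fin m → SignType) (i : Fin n) : SignType :=
  if h : (i : ℕ) < m then x ⟨i, h⟩ else 0

theorem extendZero_castLE {m n : ℕ} (h : m ≤ n) (x : Fin m → SignType) (i : Fin m) :
    extendZero x (Fin.castLE h i) = x i := by
  simp [extendZero]

theorem exists_of_extendZero_ne_zero {m n : ℕ} (h : m ≤ n) {x : Fin m → SignType} {i : Fin n}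
    (hi : extendZero x i ≠ 0) : ∃ l, Fin.castLE h l = i := by
  unfold extendZero at hi
  split_ifs at hi with h1
  · exact ⟨⟨i, h1⟩, by ext; simp⟩
  · exact absurd rfl hi

theorem signAlt_le_extendZero {m n : ℕ} (h : m ≤ n) (x : Fin m → SignType) :
    signAlt x ≤ signAlt (extendZero x : Fin n → SignType) := by
  obtain ⟨i, h1, h2, h3⟩ := exists_isAltSubseq x
  have : IsAltSubseq (extendZero x : Fin n → SignType) fun l => Fin.castLE h (i l) :=
    ⟨fun l m hlm => h1 hlm, fun l => by rw [extendZero_castLE]; exact h2 l, fun l m hlm => by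
      rw [extendZero_castLE, extendZero_castLE]; exact h3 l m hlm⟩
  exact this.le_signAlt

theorem signSupp_le_extendZero {m n : ℕ} (h : m ≤ n) (x : Fin m → SignType) :
    signSupp x ≤ signSupp (extendZero x : Fin n → SignType) := by
  refine Finset.card_le_card_of_injOn (Fin.castLE h) ?_ (Fin.castLE_injective h).injOn
  intro i hi
  simpa [extendZero_castLE] using hi

/-- Truncation gives every block the same surplus t over its alternation number. The edge condition
survives since extending by zeros lowers neither alternation nor support and adds no signed entry.
-/
theorem Hypergraph.IsNice.exists_restriction {α : Type*} {H : Hypergraph α} (hH : H.IsNice)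
    (hempty : ∅ ∉ H.edgeSet) {t : ℕ} (ht : (t : ℕ∞) ≤ H.kneserGraph.chromaticNumber) :
    ∃ (a : ℕ) (τ : Fin (a + t) → α), Injective τ ∧ ∅ ∉ {e | τ '' e ∈ H.edgeSet} ∧
      (∀ i, {i} ∉ {e | τ '' e ∈ H.edgeSet}) ∧
      ∀ x, a ≤ signAlt x → a < signSupp x → HasPos {e | τ '' e ∈ H.edgeSet} x ∨
        HasPos {e | τ '' e ∈ H.edgeSet} (-x) := by
  obtain ⟨_, hsingle, n, σ, hχ, hσ⟩ := hH
  set a := H.altOrd σ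
  have hn : a + t ≤ n := by
    have : ((a + t : ℕ) : ℕ∞) ≤ n := by
      rw [← hχ, add_comm]
      push_cast
      gcongr
    exact_mod_cast this
  set τ : Fin (a + t) → α := fun i => σ (Fin.castLE hn i) with hτ
  have hpos : ∀ (x : Fin (a + t) → SignType) (s : SignType), s ≠ 0 → ∀ e ∈ H.edgeSet,
      e ⊆ (fun i => (σ i : α)) '' {i | (extendZero x : Fin n → SignType) i = s} →
      ∃ f, τ '' f ∈ H.edgeSet ∧ f ⊆ {i | x i = s} := by
    intro x s hs e he hes
    refine ⟨{i | x i = s ∧ τ i ∈ e}, ?_, fun i hi => hi.1⟩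
    have : τ '' {i | x i = s ∧ τ i ∈ e} = e := by
      ext v
      constructor
      · rintro ⟨i, hi, rfl⟩
        exact hi.2
      · intro hv
        obtain ⟨i, hi, rfl⟩ := hes hv
        have hi' : (extendZero x : Fin n → SignType) i = s := hi
        obtain ⟨l, rfl⟩ := exists_of_extendZero_ne_zero hn (x := x) (i := i) (by rw [hi']; exact hs)
        rw [extendZero_castLE] at hi'
        exact ⟨l, ⟨hi', hv⟩, rfl⟩
    rw [this]
    exact he
  refine ⟨a, τ, ?_, by simpa using hempty, fun i => ?_, fun x h1 h2 => ?_⟩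
  · intro i l h
    exact Fin.castLE_injective hn (σ.injective (Subtype.ext h))
  · simpa using hsingle (τ i)
  · obtain ⟨e, he, h | h⟩ := hσ (extendZero x) (h1.trans (signAlt_le_extendZero hn x))
      (h2.trans_le (signSupp_le_extendZero hn x))
    · obtain ⟨f, hf, hfs⟩ := hpos x 1 (by decide) e he h
      exact Or.inl ⟨f, hf, hfs⟩
    · obtain ⟨f, hf, hfs⟩ := hpos x (-1) (by decide) e he h
      refine Or.inr ⟨f, hf, fun i hi => ?_⟩
      have : x i = -1 := hfs hi
      simp [this]

theorem exists_colorful_vertices {s : ℕ} {V : Fin s → Type*} (H : ∀ j, Hypergraph (V j))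
    (hempty : ∀ j, ∅ ∉ (H j).edgeSet) (hnice : ∀ j, (H j).IsNice) {t : ℕ}
    (hχ : ∀ j, (t : ℕ∞) ≤ (H j).kneserGraph.chromaticNumber)
    (c : (catProd fun j => (H j).kneserGraph).Coloring (Fin t)) (ht : 1 ≤ t)
    (hst : 3 ≤ t ∨ s = 1) (h0 : 0 < s) :
    ∃ A B : Fin t → ∀ j, (H j).edgeSet,
      (∀ l m, l ≠ m → (catProd fun j => (H j).kneserGraph).Adj (A l) (B m)) ∧
      (∀ l, A l ≠ B l) ∧ (Surjective fun l => c (A l)) ∧ Surjective fun l => c (B l) := by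
  classical
  choose a τ hτ hE0 hE1 hE using fun j => (hnice j).exists_restriction (hempty j) (hχ j)
  have hadj : ∀ u v : ∀ j, (H j).edgeSet, (∀ j, Disjoint (u j : Set (V j)) (v j)) →
      (catProd fun j => (H j).kneserGraph).Adj u v := by
    intro u v huv
    have hne : ∀ j, u j ≠ v j := by
      intro j h
      have := huv j
      rw [h, disjoint_self, Set.bot_eq_empty] at this
      exact hempty j (this ▸ (v j).2)
    exact ⟨fun h => hne ⟨0, h0⟩ (congrFun h _), fun j => ⟨hne j, huv j⟩⟩
  -- The default color is irrelevant: only tuples of edges matter below.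
  set c' : (∀ j, Set (Fin (a j + t))) → Fin t := fun e =>
    if h : ∀ j, τ j '' e j ∈ (H j).edgeSet then c fun j => ⟨τ j '' e j, h j⟩ else ⟨0, ht⟩ with hc'
  have hc'e : ∀ e (h : ∀ j, τ j '' e j ∈ (H j).edgeSet),
      c' e = c fun j => ⟨τ j '' e j, h j⟩ := fun e h => dif_pos h
  obtain ⟨A, B, hA, hB, hAB, hne, hcA, hcB⟩ := exists_colorful_tuples (c := c') hE0 hE1 hE
    (fun e f he hf hef => by
      rw [hc'e e he, hc'e f hf]
      exact c.valid (hadj _ _ fun j => (Set.disjoint_image_iff (hτ j)).2 (hef j))) ht hst h0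
  refine ⟨fun l j => ⟨τ j '' A l j, hA l j⟩, fun l j => ⟨τ j '' B l j, hB l j⟩,
    fun l m hlm => hadj _ _ fun j => (Set.disjoint_image_iff (hτ j)).2 (hAB l m hlm j),
    fun l h => hne l ?_, fun k => ?_, fun k => ?_⟩
  · ext1 j
    exact (hτ j).image_injective (congrArg Subtype.val (congrFun h j))
  · obtain ⟨l, hl⟩ := hcA k
    exact ⟨l, (hc'e _ (hA l)).symm.trans hl⟩
  · obtain ⟨l, hl⟩ := hcB k
    exact ⟨l, (hc'e _ (hB l)).symm.trans hl⟩

theorem exists_copy_starBipartite {W : Type*} {G : SimpleGraph W} {t : ℕ} (c : G.Coloring (Fin t))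
    {A B : Fin t → W} (hadj : ∀ l m, l ≠ m → G.Adj (A l) (B m)) (hne : ∀ l, A l ≠ B l)
    (hA : Surjective fun l => c (A l)) (hB : Surjective fun l => c (B l)) :
    ∃ f : SimpleGraph.Copy (starBipartite t) G,
      (∀ k : Fin t, ∃ i : Fin t, c (f (Sum.inl i)) = k) ∧
      (∀ k : Fin t, ∃ i : Fin t, c (f (Sum.inr i)) = k) := by
  have hAi : Injective A := fun l m h =>
    (Finite.injective_iff_surjective.2 hA) (congrArg c h)
  have hBi : Injective B := fun l m h =>
    (Finite.injective_iff_surjective.2 hB) (congrArg c h)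
  have hAB : ∀ l m, A l ≠ B m := by
    intro l m
    by_cases h : l = m
    · exact h ▸ hne l
    · exact (hadj l m h).ne
  have hmap : ∀ p q, (starBipartite t).Adj p q → G.Adj (Sum.elim A B p) (Sum.elim A B q) := by
    rintro (l | l) (m | m) h <;> simp [starBipartite] at h
    · exact hadj l m (by tauto)
    · exact (hadj m l (by tauto)).symm
  refine ⟨⟨⟨Sum.elim A B, fun {p q} h => hmap p q h⟩, ?_⟩, hA, hB⟩
  exact Injective.sumElim hAi hBi hAB

theorem exists_adj_of_two_le_chromaticNumber {W : Type*} {G : SimpleGraph W}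
    (h : ((2 : ℕ) : ℕ∞) ≤ G.chromaticNumber) : ∃ u v, G.Adj u v := by
  by_contra! hn
  have hcol : G.Colorable 1 :=
    ⟨SimpleGraph.Coloring.mk (fun _ => 0) fun {u v} huv => absurd huv (hn u v)⟩
  have := h.trans hcol.chromaticNumber_le
  norm_cast at this

end NiceHypergraphs

/-- The label argument covers t ≥ 3, and also s = 1 with t ≥ 1. What remains is t = 0, or t ≤ 2 with
at least two factors. -/
theorem theorem4p1 {s : ℕ} {V : Fin s → Type*} (H : ∀ j, Hypergraph (V j))
    (hempty : ∀ j, ∅ ∉ (H j).edgeSet) (hnice : ∀ j, (H j).IsNice) (t : ℕ)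
    (ht : IsLeast (Set.range fun j => (H j).kneserGraph.chromaticNumber) (t : ℕ∞))
    (c : (catProd fun j => (H j).kneserGraph).Coloring (Fin t)) :
    ∃ f : SimpleGraph.Copy (starBipartite t) (catProd fun j => (H j).kneserGraph),
      (∀ k : Fin t, ∃ i : Fin t, c (f (Sum.inl i)) = k) ∧
      (∀ k : Fin t, ∃ i : Fin t, c (f (Sum.inr i)) = k) := by
  classical
  obtain ⟨⟨j0, hj0⟩, hle⟩ := ht
  have hχ : ∀ j, (t : ℕ∞) ≤ (H j).kneserGraph.chromaticNumber := fun j => hle ⟨j, rfl⟩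
  have h0 : 0 < s := j0.pos
  by_cases hst : 1 ≤ t ∧ (3 ≤ t ∨ s = 1)
  · obtain ⟨A, B, hadj, hne, hA, hB⟩ :=
      exists_colorful_vertices H hempty hnice hχ c hst.1 hst.2 h0
    exact exists_copy_starBipartite c hadj hne hA hB
  obtain ⟨j1, hj1⟩ : ∃ j1 : Fin s, 1 ≤ t → j1 ≠ j0 := by
    by_cases h1 : 1 ≤ t
    · have : Nontrivial (Fin s) := Fin.nontrivial_iff_two_le.2 (by omega)
      obtain ⟨j1, hj1⟩ := exists_ne j0
      exact ⟨j1, fun _ => hj1⟩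
    · exact ⟨j0, fun h => absurd h h1⟩
  obtain rfl | rfl | rfl : t = 0 ∨ t = 1 ∨ t = 2 := by omega
  · exact exists_copy_starBipartite c (A := Fin.elim0) (B := Fin.elim0) (fun l => l.elim0)
      (fun l => l.elim0) (fun l => l.elim0) fun l => l.elim0
  -- For t = 1 the graph has two isolated vertices, so two distinct tuples suffice. The one-factor
  -- case supplies two distinct edges of `H j0`.
  · choose e he using fun j => (hnice j).1
    obtain ⟨C⟩ : (H j0).kneserGraph.Colorable 1 :=
      SimpleGraph.chromaticNumber_le_iff_colorable.1 hj0.le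
    obtain ⟨A, B, _, hne, _⟩ := exists_colorful_vertices (s := 1) (fun _ => H j0)
      (fun _ => hempty j0) (fun _ => hnice j0) (fun _ => hχ j0)
      (SimpleGraph.Coloring.mk (fun u => C (u 0)) fun {u v} huv => C.valid (huv.2 0))
      le_rfl (Or.inr rfl) one_pos
    have hne0 : A 0 0 ≠ B 0 0 := fun h => hne 0 (by
      ext1 j
      rw [Subsingleton.elim j 0, h])
    refine exists_copy_starBipartite c
      (A := fun _ => Function.update (fun j => (⟨e j, he j⟩ : (H j).edgeSet)) j0 (A 0 0))
      (B := fun _ => Function.update (fun j => (⟨e j, he j⟩ : (H j).edgeSet)) j0 (B 0 0))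
      (fun l m h => absurd (Subsingleton.elim l m) h) (fun l h => hne0 ?_)
      (fun k => ⟨k, Subsingleton.elim _ _⟩) fun k => ⟨k, Subsingleton.elim _ _⟩
    simpa using congrFun h j0
  -- For t = 2 the graph consists of two disjoint edges. The second edge comes from swapping `u` and
  -- `v` in coordinate `j0`; the coordinate `j1` keeps the four vertices distinct.
  · choose u v huv using fun j => exists_adj_of_two_le_chromaticNumber (hχ j)
    have h10 := hj1 (by omega)
    set u' := Function.update u j0 (v j0) with hu'
    set v' := Function.update v j0 (u j0) with hv'
    have hadj : (catProd fun j => (H j).kneserGraph).Adj u v :=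
      ⟨fun h => (huv j0).ne (congrFun h j0), huv⟩
    have huv' : ∀ j, (H j).kneserGraph.Adj (u' j) (v' j) := by
      intro j
      by_cases hj : j = j0
      · subst hj
        simpa [hu', hv'] using (huv j).symm
      · simpa [hu', hv', hj] using huv j
    have hadj' : (catProd fun j => (H j).kneserGraph).Adj u' v' :=
      ⟨fun h => (huv' j0).ne (congrFun h j0), huv'⟩
    have huu : u ≠ u' := fun h => (huv j0).ne (by simpa [hu'] using congrFun h j0)
    have hvv : v ≠ v' := fun h => (huv j0).ne (by simpa [hv'] using (congrFun h j0).symm)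
    have huv1 : u ≠ v' := fun h => (huv j1).ne (by simpa [hv', h10] using congrFun h j1)
    have hvu1 : u' ≠ v := fun h => (huv j1).ne (by simpa [hu', h10] using congrFun h j1)
    -- When `p` and `p'` share a color, `q` and `q'` have the other one, so the sides {p, q'} and
    -- {p', q} both see two colors.
    have key : ∀ p q p' q' : ∀ j, (H j).edgeSet,
        (catProd fun j => (H j).kneserGraph).Adj p q →
        (catProd fun j => (H j).kneserGraph).Adj p' q' → p ≠ p' → q ≠ q' → c p = c p' →
        ∃ f : SimpleGraph.Copy (starBipartite 2) (catProd fun j => (H j).kneserGraph),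
          (∀ k : Fin 2, ∃ i : Fin 2, c (f (Sum.inl i)) = k) ∧
          (∀ k : Fin 2, ∃ i : Fin 2, c (f (Sum.inr i)) = k) := by
      intro p q p' q' hpq hpq' hpp hqq hcol
      have h1 := c.valid hpq
      have h2 := c.valid hpq'
      refine exists_copy_starBipartite c (A := ![p, q']) (B := ![p', q]) ?_ ?_ ?_ ?_
      · intro l m hlm
        fin_cases l <;> fin_cases m
        · exact absurd rfl hlm
        · exact hpq
        · exact hpq'.symm
        · exact absurd rfl hlm
      · intro l
        fin_cases l
        · exact hpp
        · exact hqq.symm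
      · intro k
        by_cases hk : c p = k
        · exact ⟨0, hk⟩
        · exact ⟨1, by show c q' = k; omega⟩
      · intro k
        by_cases hk : c p' = k
        · exact ⟨0, hk⟩
        · exact ⟨1, by show c q = k; omega⟩
    have h1 := c.valid hadj
    have h2 := c.valid hadj'
    by_cases hcu : c u = c u'
    · exact key u v u' v' hadj hadj' huu hvv hcu
    · exact key u v v' u' hadj hadj'.symm huv1 hvu1.symm (by omega)
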